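/- Let $0<\kappa<1$ and $\lambda=\sqrt{1-\kappa^2}$. For complex $T$ near $0$ put $$f(T)=\int_0^T {}_2F_1\left(\tfrac14,\tfrac34;\tfrac12;\kappa^2\sin^2 t\right)\,dt ,$$ the integral being taken along the segment from $0$ to $T$. Let $\varphi$ be the analytic inverse of $f$ on a sufficiently small open disc $D$ about $0$ (so $\varphi(0)=0$), and let $\psi$ be the analytic function on $D$ with $\psi(0)=0$ and $\sin\psi=\kappa\sin\varphi$. Theorem. (i) There is exactly one meromorphic function $\mathrm{dn}_2$ on $\mathbb{C}$ whose restriction to some such disc $D$ is $\cos\psi$. (ii) There is exactly one pair of real numbers $K>0$, $K'>0$ such that $2K$ and $2iK'$ are fundamental periods of the Weierstrass function $\wp$ with invariants $g_2=\tfrac43-\kappa^2$ and $g_3=\tfrac8{27}-\tfrac13\kappa^2$, that is, such that the lattice $2K\mathbb{Z}+2iK'\mathbb{Z}$ has these invariants. (iii) The function $\mathrm{dn}_2$ is elliptic with $2K$ and $2iK'$ as fundamental periods: its set of periods is exactly $2K\mathbb{Z}+2iK'\mathbb{Z}$. It has a double pole at $iK'$; moreover $\mathrm{dn}_2(K)=\lambda$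 and $\mathrm{dn}_2(K+iK')=-\lambda$. -/

import Mathlib

noncomputable section

namespace ShenDn

/-- The function `f(T) = ∫₀ᵀ F(1/4, 3/4; 1/2; κ² sin² t) dt`, where `F = ₂F₁` and the integral is
taken along the straight segment `t = s T`, `0 ≤ s ≤ 1`, from `0` to the complex number `T`.
(It is only used for `T` near `0`, where `|κ² sin² t| < 1` on the segment.) -/
def f (κ : ℝ) (T : ℂ) : ℂ :=
  ∫ s in (0 : ℝ)..1,
    ordinaryHypergeometric (1 / 4 : ℂ) (3 / 4 : ℂ) (1 / 2 : ℂ)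
      ((κ : ℂ) ^ 2 * Complex.sin ((s : ℂ) * T) ^ 2) * T

/-- On the open disc of radius `r > 0` about `0`, `φ` is the analytic inverse of `f κ` and `ψ` is
the analytic function with `ψ 0 = 0` and `sin ψ = κ sin φ`. -/
structure IsLocalData (κ r : ℝ) (φ ψ : ℂ → ℂ) : Prop where
  radius_pos : 0 < r
  analytic_phi : AnalyticOnNhd ℂ φ (Metric.ball 0 r)
  phi_zero : φ 0 = 0
  right_inv : ∀ u ∈ Metric.ball (0 : ℂ) r, f κ (φ u) = u
  left_inv : ∀ᶠ T in nhds (0 : ℂ), φ (f κ T) = T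
  analytic_psi : AnalyticOnNhd ℂ ψ (Metric.ball 0 r)
  psi_zero : ψ 0 = 0
  sin_psi : ∀ u ∈ Metric.ball (0 : ℂ) r, Complex.sin (ψ u) = (κ : ℂ) * Complex.sin (φ u)

/-- `d` is the function `dn₂` of modulus `κ`: the meromorphic function on the whole plane that
restricts to `cos ψ` on a disc about `0`. Meromorphic functions are taken in Mathlib's normal form,
i.e. `d` is analytic at each point that is not a pole, and has the default value `0` at its poles;
so equalities of values, periodicity included, are equalities of meromorphic functions. -/
def IsDn2 (κ : ℝ) (d : ℂ → ℂ) : Prop :=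
  MeromorphicNFOn d Set.univ ∧
    ∃ (r : ℝ) (φ ψ : ℂ → ℂ), IsLocalData κ r φ ψ ∧
      ∀ u ∈ Metric.ball (0 : ℂ) r, d u = Complex.cos (ψ u)

/-- `K, K' > 0`, and `2K`, `2iK'` are fundamental periods of the Weierstrass function with
invariants `g₂ = 4/3 - κ²` and `g₃ = 8/27 - κ²/3`: these are the invariants of the lattice
that is generated by `2K` and `2iK'`. -/
def IsHalfPeriods (κ K K' : ℝ) : Prop :=
  0 < K ∧ 0 < K' ∧
    ∃ L : PeriodPair, L.ω₁ = 2 * (K : ℂ) ∧ L.ω₂ = 2 * Complex.I * (K' : ℂ) ∧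
      L.g₂ = 4 / 3 - (κ : ℂ) ^ 2 ∧ L.g₃ = 8 / 27 - (κ : ℂ) ^ 2 / 3

/-- `ω₁`, `ω₂` are fundamental periods of `d`: they are linearly independent over `ℝ`, and the
periods of `d` are exactly their integral linear combinations. -/
def IsFundamentalPeriods (d : ℂ → ℂ) (ω₁ ω₂ : ℂ) : Prop :=
  LinearIndependent ℝ ![ω₁, ω₂] ∧
    ∀ ω : ℂ, Function.Periodic d ω ↔ ∃ m n : ℤ, ω = (m : ℂ) * ω₁ + (n : ℂ) * ω₂

end ShenDn

end

/-!
The series `F(θ) = ₂F₁(1/4, 3/4; 1/2; sin² θ)` is the even part of the binomial series of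
`(1 + sin θ) ^ (-1/2)`, which gives the closed form `F(θ) = cos (θ / 2) / cos θ`. Since
`sin ψ = κ sin φ` and `φ' = 1 / F(ψ)`, the function `d = cos ψ` therefore satisfies
`d'' = 1 - κ² + 2 d - 3 d²` near `0`, together with `d 0 = 1` and `d' 0 = 0`. If a lattice with
half periods `K`, `iK'` has the stated invariants, then `u ↦ 1/3 - 2 ℘(u + iK')` satisfies the same
initial value problem, which has a unique solution; this settles existence of `dn₂`, its periods
and its pole, and it makes `K`, `K'` unique.

The roots of `4 x³ - g₂ x - g₃` are `1/6 ± √(1 - κ²)/2` and `-1/3`. On the sides of the rectangle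
with vertices `0`, `K`, `K + iK'`, `iK'` the function `℘` is real, and following the sign of the
cubic along them shows which root `℘` takes at which half period.

A rectangular lattice with prescribed real invariants and positive discriminant exists because
`E₆ / E₄ ^ (3/2)` on the imaginary axis is continuous, tends to `1` at `i∞` and changes sign
under `t ↦ 1 / t`, so it takes every value in `(-1, 1)`.
-/

namespace ShenDn

open Filter Topology
open Complex (I sin cos)
open scoped ComplexConjugate PeriodPair

/-! ### A closed form of the hypergeometric function -/

lemma succ_mul_ringChoose_succ {K : Type*} [Field K] [CharZero K] (a : K) (n : ℕ) :
    (n + 1) * Ring.choose a (n + 1) = (a - n) * Ring.choose a n := by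
  have hn : (n.factorial : K) ≠ 0 := by exact_mod_cast n.factorial_ne_zero
  have hn1 : (n + 1 : K) ≠ 0 := by exact_mod_cast n.succ_ne_zero
  rw [Ring.choose_eq_smul, Ring.choose_eq_smul, descPochhammer_succ_right, Nat.factorial_succ]
  simp only [Polynomial.smeval_mul, Polynomial.smeval_sub, Polynomial.smeval_X,
    Polynomial.smeval_natCast, smul_eq_mul, pow_one, pow_zero, nsmul_eq_mul, mul_one]
  push_cast
  field_simp

lemma ringChoose_neg_two_mul_two_mul {K : Type*} [Field K] [CharZero K] (a : K) (n : ℕ) :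
    Ring.choose (-(2 * a)) (2 * n) =
      ordinaryHypergeometricCoefficient a (a + 1 / 2) (1 / 2) n := by
  induction n with
  | zero => simp [ordinaryHypergeometricCoefficient]
  | succ n ih =>
    have hfirst := succ_mul_ringChoose_succ (-(2 * a)) (2 * n)
    have hsecond := succ_mul_ringChoose_succ (-(2 * a)) (2 * n + 1)
    have hn : (n + 1 : K) ≠ 0 := by exact_mod_cast n.succ_ne_zero
    have hn' : (2 * n + 1 : K) ≠ 0 := by exact_mod_cast (2 * n).succ_ne_zero
    rw [show 2 * (n + 1) = 2 * n + 1 + 1 by ring,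
      ← mul_right_inj' (mul_ne_zero (mul_ne_zero two_ne_zero hn) hn')]
    calc 2 * (n + 1) * (2 * n + 1) * Ring.choose (-(2 * a)) (2 * n + 1 + 1)
        = (2 * a + 2 * n) * (2 * a + 2 * n + 1) * Ring.choose (-(2 * a)) (2 * n) := by
          push_cast at hfirst hsecond
          linear_combination (2 * n + 1 : K) * hsecond - (2 * a + 2 * n + 1) * hfirst
      _ = _ := by
          rw [ih, show (1 / 2 : K) = 2⁻¹ by ring]
          simp only [ordinaryHypergeometricCoefficient, ascPochhammer_succ_eval,
            Nat.factorial_succ, mul_inv]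
          have : (2⁻¹ + n : K) = (2 * n + 1) / 2 := by ring
          push_cast
          rw [this]
          field_simp
          ring

lemma hasSum_ringChoose_mul_pow (a : ℂ) {v : ℂ} (hv : ‖v‖ < 1) :
    HasSum (fun n ↦ Ring.choose a n * v ^ n) ((1 + v) ^ a) := by
  have := (Complex.one_add_cpow_hasFPowerSeriesOnBall_zero (a := a)).hasSum (y := v)
    (by simpa [enorm_eq_nnnorm] using! hv)
  simpa [binomialSeries_apply, List.ofFn_const, List.prod_replicate,
    -FormalMultilinearSeries.apply_eq_prod_smul_coeff] using this

lemma ordinaryHypergeometric_sq (a : ℂ) {w : ℂ} (hw : ‖w‖ < 1) :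
    ordinaryHypergeometric a (a + 1 / 2) (1 / 2) (w ^ 2) =
      ((1 + w) ^ (-(2 * a)) + (1 - w) ^ (-(2 * a))) / 2 := by
  have hsum := ((hasSum_ringChoose_mul_pow (-(2 * a)) hw).add
    (hasSum_ringChoose_mul_pow (-(2 * a)) (v := -w) (by rwa [norm_neg]))).div_const 2
  have hodd (n : ℕ) (hn : n ∉ Set.range (2 * · : ℕ → ℕ)) :
      (Ring.choose (-(2 * a)) n * w ^ n + Ring.choose (-(2 * a)) n * (-w) ^ n) / 2 = 0 := by
    have : Odd n := by
      rw [← Nat.not_even_iff_odd, even_iff_exists_two_mul]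
      rintro ⟨m, rfl⟩
      exact hn ⟨m, rfl⟩
    rw [this.neg_pow]
    ring
  rw [← (mul_right_injective₀ two_ne_zero).hasSum_iff hodd, ← sub_eq_add_neg] at hsum
  rw [ordinaryHypergeometric_eq_tsum, ← hsum.tsum_eq]
  refine tsum_congr fun n ↦ ?_
  simp only [Function.comp_apply, (even_two_mul n).neg_pow, ringChoose_neg_two_mul_two_mul,
    pow_mul, smul_eq_mul]
  ring

lemma sq_cpow_neg_half {x : ℂ} (hx : 0 < x.re) : (x ^ 2) ^ (-(1 / 2) : ℂ) = x⁻¹ := by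
  have harg := abs_lt.1 (Complex.abs_arg_lt_pi_div_two_iff.2 (Or.inl hx))
  rw [Complex.cpow_neg, one_div]
  exact_mod_cast congrArg (·⁻¹) <| Complex.pow_cpow_nat_inv (x := x) two_ne_zero
    (by exact_mod_cast harg.1) (by exact_mod_cast harg.2.le)

lemma sin_eq_two_mul_sin_half_mul_cos_half (z : ℂ) : sin z = 2 * sin (z / 2) * cos (z / 2) := by
  rw [← Complex.sin_two_mul, mul_div_cancel₀ z two_ne_zero]

lemma cos_eq_two_mul_cos_half_sq_sub_one (z : ℂ) : cos z = 2 * cos (z / 2) ^ 2 - 1 := by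
  rw [← Complex.cos_two_mul, mul_div_cancel₀ z two_ne_zero]

lemma cos_half_add_sin_half_sq (z : ℂ) : (cos (z / 2) + sin (z / 2)) ^ 2 = 1 + sin z := by
  rw [sin_eq_two_mul_sin_half_mul_cos_half z]
  linear_combination Complex.sin_sq_add_cos_sq (z / 2)

lemma cos_half_sub_sin_half_sq (z : ℂ) : (cos (z / 2) - sin (z / 2)) ^ 2 = 1 - sin z := by
  rw [sin_eq_two_mul_sin_half_mul_cos_half z]
  linear_combination Complex.sin_sq_add_cos_sq (z / 2)

lemma ordinaryHypergeometric_sin_sq {p : ℂ} (hsin : ‖sin p‖ < 1)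
    (hadd : 0 < (cos (p / 2) + sin (p / 2)).re) (hsub : 0 < (cos (p / 2) - sin (p / 2)).re) :
    ordinaryHypergeometric (1 / 4 : ℂ) (3 / 4 : ℂ) (1 / 2 : ℂ) (sin p ^ 2) =
      cos (p / 2) / cos p := by
  have hadd' : cos (p / 2) + sin (p / 2) ≠ 0 := fun h ↦ by simp [h] at hadd
  have hsub' : cos (p / 2) - sin (p / 2) ≠ 0 := fun h ↦ by simp [h] at hsub
  have hcos : cos p = (cos (p / 2) + sin (p / 2)) * (cos (p / 2) - sin (p / 2)) := by
    rw [cos_eq_two_mul_cos_half_sq_sub_one p]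
    linear_combination Complex.sin_sq_add_cos_sq (p / 2)
  have hsq := ordinaryHypergeometric_sq (1 / 4) hsin
  rw [show (1 / 4 + 1 / 2 : ℂ) = 3 / 4 by norm_num, show (2 * (1 / 4) : ℂ) = 1 / 2 by norm_num,
    ← cos_half_add_sin_half_sq, ← cos_half_sub_sin_half_sq, sq_cpow_neg_half hadd,
    sq_cpow_neg_half hsub] at hsq
  rw [hsq, hcos]
  field_simp
  ring

lemma eventually_ordinaryHypergeometric_sin_sq : ∀ᶠ p in 𝓝 (0 : ℂ),
    ordinaryHypergeometric (1 / 4 : ℂ) (3 / 4 : ℂ) (1 / 2 : ℂ) (sin p ^ 2) =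
      cos (p / 2) / cos p := by
  have hsin : ∀ᶠ p in 𝓝 (0 : ℂ), ‖sin p‖ < 1 :=
    ContinuousAt.eventually_lt (by fun_prop) continuousAt_const (by simp)
  have hadd : ∀ᶠ p in 𝓝 (0 : ℂ), 0 < (cos (p / 2) + sin (p / 2)).re :=
    continuousAt_const.eventually_lt
      (by fun_prop : Continuous fun p ↦ (cos (p / 2) + sin (p / 2)).re).continuousAt (by simp)
  have hsub : ∀ᶠ p in 𝓝 (0 : ℂ), 0 < (cos (p / 2) - sin (p / 2)).re :=
    continuousAt_const.eventually_lt
      (by fun_prop : Continuous fun p ↦ (cos (p / 2) - sin (p / 2)).re).continuousAt (by simp)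
  filter_upwards [hsin, hadd, hsub] with p using ordinaryHypergeometric_sin_sq

/-! ### The integral along segments -/

lemma one_le_radius_ordinaryHypergeometricSeries {𝕂 : Type*} [RCLike 𝕂] (𝔸 : Type*)
    [NormedDivisionRing 𝔸] [NormedAlgebra 𝕂 𝔸] (a b c : 𝕂) :
    1 ≤ (ordinaryHypergeometricSeries 𝔸 a b c).radius := by
  by_cases h : ∀ k : ℕ, (k : 𝕂) ≠ -a ∧ (k : 𝕂) ≠ -b ∧ (k : 𝕂) ≠ -c
  · rw [ordinaryHypergeometricSeries_radius_eq_one 𝔸 a b c h]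
  · simp only [ne_eq, ← not_or, not_forall, not_not] at h
    obtain ⟨k, h⟩ := h
    simp only [eq_comm (a := (k : 𝕂)), neg_eq_iff_eq_neg] at h
    rcases h with rfl | rfl | rfl
    · simp [ordinaryHypergeometric_radius_top_of_neg_nat₁]
    · simp [ordinaryHypergeometric_radius_top_of_neg_nat₂]
    · simp [ordinaryHypergeometric_radius_top_of_neg_nat₃]

lemma analyticAt_ordinaryHypergeometric_zero {𝕂 : Type*} [RCLike 𝕂] {𝔸 : Type*}
    [NormedDivisionRing 𝔸] [NormedAlgebra 𝕂 𝔸] [CompleteSpace 𝔸] (a b c : 𝕂) :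
    AnalyticAt 𝕂 (ordinaryHypergeometric a b c : 𝔸 → 𝔸) 0 :=
  ⟨_, (FormalMultilinearSeries.hasFPowerSeriesOnBall _ (zero_lt_one.trans_le
    (one_le_radius_ordinaryHypergeometricSeries 𝔸 a b c))).hasFPowerSeriesAt⟩

section Primitive

variable {E : Type*} [NormedAddCommGroup E] [NormedSpace ℂ E] [CompleteSpace E] {g : ℂ → E}

lemma integral_segment_eq_sub {G : ℂ → E} {ρ : ℝ} {T : ℂ} (hg : ContinuousOn g (Metric.ball 0 ρ))
    (hG : ∀ z ∈ Metric.ball (0 : ℂ) ρ, HasDerivAt G (g z) z) (hT : T ∈ Metric.ball (0 : ℂ) ρ) :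
    ∫ s in (0 : ℝ)..1, T • g (s * T) = G T - G 0 := by
  have hmem : ∀ s ∈ Set.uIcc (0 : ℝ) 1, (s : ℂ) * T ∈ Metric.ball (0 : ℂ) ρ := by
    intro s hs
    rw [Set.uIcc_of_le zero_le_one] at hs
    rw [mem_ball_zero_iff] at hT ⊢
    rw [norm_mul, Complex.norm_real, Real.norm_of_nonneg hs.1]
    exact (mul_le_of_le_one_left (norm_nonneg _) hs.2).trans_lt hT
  have hderiv : ∀ s ∈ Set.uIcc (0 : ℝ) 1,
      HasDerivAt (fun s : ℝ ↦ G (s * T)) (T • g (s * T)) s := fun s hs ↦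
    (hG _ (hmem s hs)).scomp s ((hasDerivAt_mul_const T).comp_ofReal)
  have hcont : ContinuousOn (fun s : ℝ ↦ T • g (s * T)) (Set.uIcc 0 1) :=
    (hg.comp (by fun_prop) hmem).const_smul T
  simpa using intervalIntegral.integral_eq_sub_of_hasDerivAt hderiv hcont.intervalIntegrable

lemma eventually_hasDerivAt_integral_segment (hg : AnalyticAt ℂ g 0) :
    ∀ᶠ T in 𝓝 (0 : ℂ), HasDerivAt (fun T ↦ ∫ s in (0 : ℝ)..1, T • g (s * T)) (g T) T := by
  obtain ⟨ρ, hρ, hball⟩ := Metric.eventually_nhds_iff_ball.1 hg.eventually_analyticAt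
  have hd : DifferentiableOn ℂ g (Metric.ball 0 ρ) := fun z hz ↦
    (hball z hz).differentiableAt.differentiableWithinAt
  obtain ⟨G, hG⟩ := hd.isExactOn_ball
  filter_upwards [Metric.ball_mem_nhds (0 : ℂ) hρ] with T hT
  refine ((hG T hT).sub_const (G 0)).congr_of_eventuallyEq ?_
  filter_upwards [Metric.isOpen_ball.mem_nhds hT] with z hz
    using integral_segment_eq_sub hd.continuousOn hG hz

end Primitive

lemma eventually_hasDerivAt_f (κ : ℝ) : ∀ᶠ T in 𝓝 (0 : ℂ), HasDerivAt (f κ)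
    (ordinaryHypergeometric (1 / 4 : ℂ) (3 / 4 : ℂ) (1 / 2 : ℂ) ((κ : ℂ) ^ 2 * sin T ^ 2)) T := by
  have hg : AnalyticAt ℂ (fun T : ℂ ↦ ordinaryHypergeometric (1 / 4 : ℂ) (3 / 4 : ℂ) (1 / 2 : ℂ)
      ((κ : ℂ) ^ 2 * sin T ^ 2)) 0 :=
    AnalyticAt.fun_comp (by simpa using analyticAt_ordinaryHypergeometric_zero _ _ _)
      (analyticAt_const.mul (Complex.analyticAt_sin.pow 2))
  have hf : f κ = fun T ↦ ∫ s in (0 : ℝ)..1, T • ordinaryHypergeometric (1 / 4 : ℂ) (3 / 4 : ℂ)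
      (1 / 2 : ℂ) ((κ : ℂ) ^ 2 * sin (s * T) ^ 2) := by
    funext T
    simp only [f, smul_eq_mul, mul_comm T]
  exact hf ▸ eventually_hasDerivAt_integral_segment hg

lemma f_zero (κ : ℝ) : f κ 0 = 0 := by simp [f]

lemma analyticAt_f (κ : ℝ) : AnalyticAt ℂ (f κ) 0 := by
  rw [Complex.analyticAt_iff_eventually_differentiableAt]
  exact (eventually_hasDerivAt_f κ).mono fun T h ↦ h.differentiableAt

lemma deriv_f_zero (κ : ℝ) : deriv (f κ) 0 = 1 := by
  simp [(eventually_hasDerivAt_f κ).self_of_nhds.deriv]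

/-! ### The germ of `dn₂` -/

lemma exists_analyticAt_inverse {𝕜 : Type*} [NontriviallyNormedField 𝕜] [CompleteSpace 𝕜]
    [CharZero 𝕜] {h : 𝕜 → 𝕜} {z : 𝕜} (hh : AnalyticAt 𝕜 h z) (h' : deriv h z ≠ 0) :
    ∃ k : 𝕜 → 𝕜, AnalyticAt 𝕜 k (h z) ∧ (∀ᶠ u in 𝓝 (h z), h (k u) = u) ∧
      ∀ᶠ T in 𝓝 z, k (h T) = T :=
  ⟨_, hh.analyticAt_localInverse h', hh.hasStrictDerivAt.eventually_right_inverse h',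
    hh.hasStrictDerivAt.eventually_left_inverse h'⟩

lemma exists_isLocalData (κ : ℝ) : ∃ (r : ℝ) (φ ψ : ℂ → ℂ), IsLocalData κ r φ ψ := by
  obtain ⟨φ, hφ, hφ_right, hφ_left⟩ := exists_analyticAt_inverse (analyticAt_f κ)
    (by rw [deriv_f_zero]; exact one_ne_zero)
  obtain ⟨arcsin, harcsin, harcsin_right, harcsin_left⟩ :=
    exists_analyticAt_inverse (Complex.analyticAt_sin (x := 0)) (by simp)
  have hφ0 : φ 0 = 0 := by simpa [f_zero] using hφ_left.self_of_nhds
  have harcsin0 : arcsin 0 = 0 := by simpa using harcsin_left.self_of_nhds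
  rw [f_zero] at hφ hφ_right
  rw [Complex.sin_zero] at harcsin harcsin_right
  have hsin : AnalyticAt ℂ (fun u ↦ κ * sin (φ u)) 0 :=
    analyticAt_const.mul (Complex.analyticAt_sin.comp hφ)
  have hsin0 : (κ : ℂ) * sin (φ 0) = 0 := by simp [hφ0]
  have hψ : AnalyticAt ℂ (fun u ↦ arcsin (κ * sin (φ u))) 0 :=
    AnalyticAt.fun_comp (hsin0.symm ▸ harcsin) hsin
  have hsin_psi : ∀ᶠ u in 𝓝 (0 : ℂ), sin (arcsin (κ * sin (φ u))) = κ * sin (φ u) :=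
    hsin.continuousAt.eventually (hsin0.symm ▸ harcsin_right)
  obtain ⟨r, hr, hball⟩ := Metric.eventually_nhds_iff_ball.1
    (hφ.eventually_analyticAt.and (hψ.eventually_analyticAt.and (hφ_right.and hsin_psi)))
  exact ⟨r, φ, _, hr, fun u hu ↦ (hball u hu).1, hφ0, fun u hu ↦ (hball u hu).2.2.1, hφ_left,
    fun u hu ↦ (hball u hu).2.1, by simp [hφ0, harcsin0], fun u hu ↦ (hball u hu).2.2.2⟩

namespace IsLocalData

variable {κ r : ℝ} {φ ψ : ℂ → ℂ}

lemma mono (h : IsLocalData κ r φ ψ) {ρ : ℝ} (hρ : 0 < ρ) (hρr : ρ ≤ r) :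
    IsLocalData κ ρ φ ψ :=
  have hsub := Metric.ball_subset_ball hρr
  ⟨hρ, h.analytic_phi.mono hsub, h.phi_zero, fun u hu ↦ h.right_inv u (hsub hu), h.left_inv,
    h.analytic_psi.mono hsub, h.psi_zero, fun u hu ↦ h.sin_psi u (hsub hu)⟩

lemma eventually_mem_ball (h : IsLocalData κ r φ ψ) : ∀ᶠ u in 𝓝 (0 : ℂ), u ∈ Metric.ball 0 r :=
  Metric.ball_mem_nhds 0 h.radius_pos

lemma analyticAt_phi (h : IsLocalData κ r φ ψ) : AnalyticAt ℂ φ 0 :=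
  h.analytic_phi 0 (Metric.mem_ball_self h.radius_pos)

lemma analyticAt_psi (h : IsLocalData κ r φ ψ) : AnalyticAt ℂ ψ 0 :=
  h.analytic_psi 0 (Metric.mem_ball_self h.radius_pos)

lemma tendsto_phi (h : IsLocalData κ r φ ψ) : Tendsto φ (𝓝 0) (𝓝 0) := by
  simpa only [h.phi_zero] using h.analyticAt_phi.continuousAt.tendsto

lemma tendsto_psi (h : IsLocalData κ r φ ψ) : Tendsto ψ (𝓝 0) (𝓝 0) := by
  simpa only [h.psi_zero] using h.analyticAt_psi.continuousAt.tendsto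

lemma eventually_cos_psi_ne_zero (h : IsLocalData κ r φ ψ) :
    ∀ᶠ u in 𝓝 (0 : ℂ), cos (ψ u) ≠ 0 :=
  h.tendsto_psi.eventually (Complex.continuous_cos.continuousAt.eventually_ne (by simp))

lemma eventually_cos_half_psi_ne_zero (h : IsLocalData κ r φ ψ) :
    ∀ᶠ u in 𝓝 (0 : ℂ), cos (ψ u / 2) ≠ 0 :=
  h.tendsto_psi.eventually <|
    (by fun_prop : Continuous fun p : ℂ ↦ cos (p / 2)).continuousAt.eventually_ne (by simp)

lemma eventually_hasDerivAt_phi (h : IsLocalData κ r φ ψ) :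
    ∀ᶠ u in 𝓝 (0 : ℂ), HasDerivAt φ (cos (ψ u) / cos (ψ u / 2)) u := by
  filter_upwards [h.eventually_mem_ball, h.tendsto_phi.eventually (eventually_hasDerivAt_f κ),
    h.tendsto_psi.eventually eventually_ordinaryHypergeometric_sin_sq,
    h.eventually_cos_psi_ne_zero, h.eventually_cos_half_psi_ne_zero] with u hu hf hF hcos hcos2
  rw [← mul_pow, ← h.sin_psi u hu, hF] at hf
  have hφ := (h.analytic_phi u hu).differentiableAt.hasDerivAt
  have hid : (fun u ↦ f κ (φ u)) =ᶠ[𝓝 u] id := by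
    filter_upwards [Metric.isOpen_ball.mem_nhds hu] with z hz using h.right_inv z hz
  have hchain : cos (ψ u / 2) / cos (ψ u) * deriv φ u = 1 :=
    (hf.comp u hφ).unique ((hasDerivAt_id u).congr_of_eventuallyEq hid)
  have hval : cos (ψ u) / cos (ψ u / 2) = deriv φ u := by
    field_simp at hchain ⊢
    exact hchain.symm
  rwa [hval]

lemma eventually_hasDerivAt_psi (h : IsLocalData κ r φ ψ) :
    ∀ᶠ u in 𝓝 (0 : ℂ), HasDerivAt ψ (κ * cos (φ u) / cos (ψ u / 2)) u := by
  filter_upwards [h.eventually_mem_ball, h.eventually_hasDerivAt_phi,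
    h.eventually_cos_psi_ne_zero] with u hu hφ hcos
  have hψ := (h.analytic_psi u hu).differentiableAt.hasDerivAt
  have hsin : (fun u ↦ sin (ψ u)) =ᶠ[𝓝 u] fun u ↦ κ * sin (φ u) := by
    filter_upwards [Metric.isOpen_ball.mem_nhds hu] with z hz using h.sin_psi z hz
  have hchain : cos (ψ u) * deriv ψ u = κ * (cos (φ u) * (cos (ψ u) / cos (ψ u / 2))) :=
    hψ.csin.unique ((hφ.csin.const_mul (κ : ℂ)).congr_of_eventuallyEq hsin)
  have hval : κ * cos (φ u) / cos (ψ u / 2) = deriv ψ u := by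
    refine mul_left_cancel₀ hcos (.trans ?_ hchain.symm)
    ring
  rwa [hval]

lemma eventually_hasDerivAt_cos_psi (h : IsLocalData κ r φ ψ) :
    ∀ᶠ u in 𝓝 (0 : ℂ), HasDerivAt (fun u ↦ cos (ψ u)) (-2 * κ * sin (ψ u / 2) * cos (φ u)) u := by
  filter_upwards [h.eventually_hasDerivAt_psi, h.eventually_cos_half_psi_ne_zero] with u hψ hcos
  convert hψ.ccos using 1
  rw [sin_eq_two_mul_sin_half_mul_cos_half (ψ u)]
  field_simp

lemma eventually_hasDerivAt_sin_half_psi_mul_cos_phi (h : IsLocalData κ r φ ψ) :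
    ∀ᶠ u in 𝓝 (0 : ℂ), HasDerivAt (fun u ↦ -2 * κ * sin (ψ u / 2) * cos (φ u))
      (1 - κ ^ 2 + 2 * cos (ψ u) - 3 * cos (ψ u) ^ 2) u := by
  filter_upwards [h.eventually_mem_ball, h.eventually_hasDerivAt_psi, h.eventually_hasDerivAt_phi,
    h.eventually_cos_half_psi_ne_zero] with u hu hψ hφ hcos
  refine ((((hψ.div_const 2).csin).const_mul (-2 * (κ : ℂ))).fun_mul hφ.ccos).congr_deriv ?_
  have hsin := sin_eq_two_mul_sin_half_mul_cos_half (ψ u)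
  have hhalf : 4 * sin (ψ u / 2) ^ 2 = 2 - 2 * cos (ψ u) := by
    rw [cos_eq_two_mul_cos_half_sq_sub_one (ψ u)]
    linear_combination 4 * Complex.sin_sq_add_cos_sq (ψ u / 2)
  have hκcos : (κ * cos (φ u)) ^ 2 = κ ^ 2 - sin (ψ u) ^ 2 := by
    rw [h.sin_psi u hu]
    linear_combination (κ : ℂ) ^ 2 * Complex.sin_sq_add_cos_sq (φ u)
  calc -2 * κ * (cos (ψ u / 2) * (κ * cos (φ u) / cos (ψ u / 2) / 2)) * cos (φ u) +
        -2 * κ * sin (ψ u / 2) * (-sin (φ u) * (cos (ψ u) / cos (ψ u / 2)))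
      = -(κ * cos (φ u)) ^ 2 + 2 * sin (ψ u / 2) * (κ * sin (φ u)) *
          (cos (ψ u) / cos (ψ u / 2)) := by
        field_simp
    _ = -(κ * cos (φ u)) ^ 2 + 4 * sin (ψ u / 2) ^ 2 * cos (ψ u) := by
        rw [← h.sin_psi u hu, hsin]
        field_simp
        ring
    _ = 1 - κ ^ 2 + 2 * cos (ψ u) - 3 * cos (ψ u) ^ 2 := by
        rw [hκcos, hhalf]
        linear_combination Complex.sin_sq_add_cos_sq (ψ u)

end IsLocalData

/-- The germ of `dn₂` at `0`: the solution of `d'' = 1 - κ² + 2 d - 3 d²`, `d 0 = 1`, `d' 0 = 0`. -/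
structure IsDn2Germ (κ : ℝ) (d : ℂ → ℂ) : Prop where
  analyticAt : AnalyticAt ℂ d 0
  apply_zero : d 0 = 1
  deriv_zero : deriv d 0 = 0
  deriv_deriv : ∀ᶠ u in 𝓝 (0 : ℂ), deriv (deriv d) u = 1 - (κ : ℂ) ^ 2 + 2 * d u - 3 * d u ^ 2

lemma IsLocalData.isDn2Germ {κ r : ℝ} {φ ψ : ℂ → ℂ} (h : IsLocalData κ r φ ψ) :
    IsDn2Germ κ fun u ↦ cos (ψ u) where
  analyticAt := Complex.analyticAt_cos.fun_comp h.analyticAt_psi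
  apply_zero := by simp [h.psi_zero]
  deriv_zero := by simp [h.eventually_hasDerivAt_cos_psi.self_of_nhds.deriv, h.psi_zero]
  deriv_deriv := by
    filter_upwards [h.eventually_hasDerivAt_cos_psi.eventually_nhds,
      h.eventually_hasDerivAt_sin_half_psi_mul_cos_phi] with u hcos hderiv
    exact (hderiv.congr_of_eventuallyEq (hcos.mono fun z hz ↦ hz.deriv)).deriv

-- A nonzero germ `w` of order `n` has `w''` of order at least `n` only if `n ≤ 1`.
lemma eventually_eq_zero_of_deriv_deriv_eq_smul {𝕜 E : Type*} [NontriviallyNormedField 𝕜]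
    [CharZero 𝕜] [NormedAddCommGroup E] [NormedSpace 𝕜 E] [CompleteSpace E] {w : 𝕜 → E}
    {h : 𝕜 → 𝕜} {z : 𝕜} (hw : AnalyticAt 𝕜 w z) (hh : AnalyticAt 𝕜 h z) (h0 : w z = 0)
    (h1 : deriv w z = 0) (hode : deriv (deriv w) =ᶠ[𝓝 z] fun u ↦ h u • w u) :
    ∀ᶠ u in 𝓝 z, w u = 0 := by
  rw [← analyticOrderAt_eq_top]
  have hderiv := hw.analyticOrderAt_deriv_add_one
  have hderiv2 := hw.deriv.analyticOrderAt_deriv_add_one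
  have hsmul : analyticOrderAt (fun u ↦ h u • w u) z = analyticOrderAt h z + analyticOrderAt w z :=
    analyticOrderAt_smul hh hw
  simp only [h0, h1, sub_zero] at hderiv hderiv2
  by_contra hne
  have hlt : analyticOrderAt w z < analyticOrderAt w z :=
    calc analyticOrderAt w z
        < analyticOrderAt w z + 1 := ENat.lt_add_one_iff hne |>.2 le_rfl
      _ ≤ analyticOrderAt h z + analyticOrderAt w z + 1 := by gcongr; exact le_add_self
      _ ≤ analyticOrderAt h z + analyticOrderAt w z + 1 + 1 := le_self_add
      _ = analyticOrderAt w z := by rw [← hsmul, ← analyticOrderAt_congr hode, hderiv2, hderiv]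
  exact hlt.false

namespace IsDn2Germ

variable {κ : ℝ} {d e : ℂ → ℂ}

lemma congr (hd : IsDn2Germ κ d) (h : e =ᶠ[𝓝 0] d) : IsDn2Germ κ e where
  analyticAt := hd.analyticAt.congr h.symm
  apply_zero := h.self_of_nhds.trans hd.apply_zero
  deriv_zero := h.deriv_eq.trans hd.deriv_zero
  deriv_deriv := by
    filter_upwards [h, h.deriv.deriv, hd.deriv_deriv] with u heq hderiv hode
    rw [hderiv, hode, heq]

-- The difference `w = d - e` solves the linear equation `w'' = (2 - 3 (d + e)) w`.
lemma eventuallyEq (hd : IsDn2Germ κ d) (he : IsDn2Germ κ e) : d =ᶠ[𝓝 0] e := by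
  have hderiv : deriv (d - e) =ᶠ[𝓝 0] deriv d - deriv e := by
    filter_upwards [hd.analyticAt.eventually_analyticAt, he.analyticAt.eventually_analyticAt]
      with u hdu heu using deriv_sub hdu.differentiableAt heu.differentiableAt
  have hderiv2 : deriv (deriv (d - e)) =ᶠ[𝓝 0] deriv (deriv d) - deriv (deriv e) := by
    filter_upwards [hderiv.deriv, hd.analyticAt.deriv.eventually_analyticAt,
      he.analyticAt.deriv.eventually_analyticAt] with u hu hdu heu
    rw [hu, deriv_sub hdu.differentiableAt heu.differentiableAt, Pi.sub_apply]
  have hcoeff : AnalyticAt ℂ (fun u ↦ 2 - 3 * (d u + e u)) 0 :=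
    analyticAt_const.sub (analyticAt_const.mul (hd.analyticAt.add he.analyticAt))
  have hzero := eventually_eq_zero_of_deriv_deriv_eq_smul (hd.analyticAt.sub he.analyticAt) hcoeff
    (by simp [hd.apply_zero, he.apply_zero])
    (by simp [hderiv.self_of_nhds, hd.deriv_zero, he.deriv_zero]) <| by
      filter_upwards [hderiv2, hd.deriv_deriv, he.deriv_deriv] with u hu hdu heu
      rw [hu, Pi.sub_apply, Pi.sub_apply, hdu, heu, smul_eq_mul]
      ring
  exact hzero.mono fun u hu ↦ sub_eq_zero.1 hu

end IsDn2Germ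

lemma isDn2_iff {κ : ℝ} {d : ℂ → ℂ} :
    IsDn2 κ d ↔ MeromorphicNFOn d Set.univ ∧ IsDn2Germ κ d := by
  refine and_congr_right fun _ ↦ ⟨?_, fun hd ↦ ?_⟩
  · rintro ⟨r, φ, ψ, h, hd⟩
    exact h.isDn2Germ.congr (h.eventually_mem_ball.mono hd)
  · obtain ⟨r, φ, ψ, h⟩ := exists_isLocalData κ
    obtain ⟨ε, hε, hball⟩ := Metric.eventually_nhds_iff_ball.1 (hd.eventuallyEq h.isDn2Germ)
    exact ⟨min r ε, φ, ψ, h.mono (lt_min h.radius_pos hε) (min_le_left r ε),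
      fun u hu ↦ hball u (Metric.ball_subset_ball (min_le_right r ε) hu)⟩

lemma eqOn_of_meromorphicNFOn_of_eventuallyEq {𝕜 E : Type*} [NontriviallyNormedField 𝕜]
    [NormedAddCommGroup E] [NormedSpace 𝕜 E] {U : Set 𝕜} {d e : 𝕜 → E} {z : 𝕜}
    (hd : MeromorphicNFOn d U) (he : MeromorphicNFOn e U) (hU : IsPreconnected U) (hz : z ∈ U)
    (h : d =ᶠ[𝓝[≠] z] e) : Set.EqOn d e U := by
  have hsub : MeromorphicOn (d - e) U := hd.meromorphicOn.sub he.meromorphicOn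
  have htop : meromorphicOrderAt (d - e) z = ⊤ :=
    meromorphicOrderAt_eq_top_iff.2 (h.mono fun u hu ↦ sub_eq_zero.2 hu)
  intro u hu
  have hu_top : meromorphicOrderAt (d - e) u = ⊤ := by
    by_contra hne
    exact hsub.meromorphicOrderAt_ne_top_of_isPreconnected hU hu hz hne htop
  have heq : d =ᶠ[𝓝[≠] u] e :=
    (meromorphicOrderAt_eq_top_iff.1 hu_top).mono fun v hv ↦ sub_eq_zero.1 hv
  exact (((hd hu).eventuallyEq_nhdsNE_iff_eventuallyEq_nhds (he hu)).1 heq).self_of_nhds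

lemma IsDn2.unique {κ : ℝ} {d e : ℂ → ℂ} (hd : IsDn2 κ d) (he : IsDn2 κ e) : d = e := by
  rw [isDn2_iff] at hd he
  exact Set.eqOn_univ d e |>.1 <| eqOn_of_meromorphicNFOn_of_eventuallyEq hd.1 he.1
    isPreconnected_univ (Set.mem_univ 0) ((hd.2.eventuallyEq he.2).filter_mono nhdsWithin_le_nhds)

/-! ### The Weierstrass function -/

section Weierstrass

variable (L : PeriodPair)

lemma isConnected_compl_lattice : IsConnected (L.lattice : Set ℂ)ᶜ := by
  refine Set.Countable.isConnected_compl_of_one_lt_rank (by simp) ?_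
  refine (Set.countable_range fun p : ℤ × ℤ ↦ (p.1 : ℂ) * L.ω₁ + p.2 * L.ω₂).mono fun x hx ↦ ?_
  obtain ⟨m, n, h⟩ := PeriodPair.mem_lattice.1 hx
  exact ⟨(m, n), h⟩

lemma eventually_notMem_lattice (x : ℂ) : ∀ᶠ z in 𝓝[≠] x, z ∉ L.lattice := by
  filter_upwards [self_mem_nhdsWithin,
    mem_nhdsWithin_of_mem_nhds (L.compl_lattice_sdiff_singleton_mem_nhds x)] with z hz hz'
  exact fun hzL ↦ hz' ⟨hzL, hz⟩

lemma tendsto_sq_mul_weierstrassP : Tendsto (fun z ↦ z ^ 2 * ℘[L] z) (𝓝[≠] 0) (𝓝 1) := by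
  have hcont : ContinuousAt (fun z ↦ z ^ 2 * L.weierstrassPExcept 0 z + 1) 0 := by
    have := (L.analyticAt_weierstrassPExcept 0).continuousAt
    fun_prop
  have hlim : Tendsto (fun z ↦ z ^ 2 * L.weierstrassPExcept 0 z + 1) (𝓝[≠] 0) (𝓝 1) := by
    simpa using hcont.tendsto.mono_left nhdsWithin_le_nhds
  refine hlim.congr' ?_
  filter_upwards [self_mem_nhdsWithin] with z hz
  simpa [Set.mem_compl_singleton_iff.1 hz] using
    (L.ite_eq_one_sub_sq_mul_weierstrassP 0 L.lattice.zero_mem z).symm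

lemma tendsto_re_sq_mul_weierstrassP_ray {v : ℂ} (hv : v ≠ 0) :
    Tendsto (fun t : ℝ ↦ (v ^ 2 * ℘[L] (v * t)).re) (𝓝[>] 0) atTop := by
  have hray : Tendsto (fun t : ℝ ↦ v * t) (𝓝[>] 0) (𝓝[≠] 0) := by
    refine tendsto_nhdsWithin_iff.2 ⟨?_, ?_⟩
    · exact (Continuous.tendsto' (by fun_prop) 0 0 (by simp)).mono_left nhdsWithin_le_nhds
    · filter_upwards [self_mem_nhdsWithin] with t ht
      exact mul_ne_zero hv (Complex.ofReal_ne_zero.2 (Set.mem_Ioi.1 ht).ne')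
  have hinv : Tendsto (fun t : ℝ ↦ (t⁻¹) ^ 2) (𝓝[>] 0) atTop :=
    (tendsto_pow_atTop two_ne_zero).comp tendsto_inv_nhdsGT_zero
  have hre := (Complex.continuous_re.tendsto 1).comp ((tendsto_sq_mul_weierstrassP L).comp hray)
  refine (hre.pos_mul_atTop (by simp) hinv).congr' ?_
  filter_upwards [self_mem_nhdsWithin] with t ht
  have ht0 : (t : ℂ) ≠ 0 := Complex.ofReal_ne_zero.2 (Set.mem_Ioi.1 ht).ne'
  rw [Function.comp_apply, Function.comp_apply, ← Complex.re_mul_ofReal]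
  congr 1
  push_cast
  field_simp

lemma hasDerivAt_weierstrassP {z : ℂ} (hz : z ∉ L.lattice) : HasDerivAt ℘[L] (℘'[L] z) z := by
  rw [← L.deriv_weierstrassP]
  exact (L.analyticOnNhd_weierstrassP z hz).differentiableAt.hasDerivAt

-- Otherwise multiplying the differential equation by `z ^ 6` and letting `z → 0` gives `4 = 0`.
lemma not_eqOn_derivWeierstrassP_zero : ¬ Set.EqOn ℘'[L] 0 (L.lattice : Set ℂ)ᶜ := by
  intro h
  have hP := tendsto_sq_mul_weierstrassP L
  have hid : Tendsto (fun z : ℂ ↦ z) (𝓝[≠] 0) (𝓝 0) := tendsto_id.mono_left nhdsWithin_le_nhds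
  have hcubic : Tendsto (fun z ↦ 4 * (z ^ 2 * ℘[L] z) ^ 3 -
      L.g₂ * z ^ 4 * (z ^ 2 * ℘[L] z) - L.g₃ * z ^ 6) (𝓝[≠] 0)
      (𝓝 (4 * 1 ^ 3 - L.g₂ * 0 ^ 4 * 1 - L.g₃ * 0 ^ 6)) :=
    (((hP.pow 3).const_mul 4).sub (((hid.pow 4).const_mul _).mul hP)).sub
      ((hid.pow 6).const_mul _)
  have hzero : (fun z ↦ 4 * (z ^ 2 * ℘[L] z) ^ 3 -
      L.g₂ * z ^ 4 * (z ^ 2 * ℘[L] z) - L.g₃ * z ^ 6) =ᶠ[𝓝[≠] 0] fun _ ↦ 0 := by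
    filter_upwards [eventually_notMem_lattice L 0] with z hz
    have hsq := L.derivWeierstrassP_sq z hz
    rw [h hz, Pi.zero_apply] at hsq
    linear_combination -z ^ 6 * hsq
  have := tendsto_nhds_unique (hcubic.congr' hzero) tendsto_const_nhds
  norm_num at this

lemma eventually_derivWeierstrassP_ne_zero {z : ℂ} (hz : z ∉ L.lattice) :
    ∀ᶠ w in 𝓝[≠] z, ℘'[L] w ≠ 0 :=
  (L.analyticOnNhd_derivWeierstrassP z hz).eventually_eq_zero_or_eventually_ne_zero.resolve_left
    fun h ↦ not_eqOn_derivWeierstrassP_zero L <|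
      L.analyticOnNhd_derivWeierstrassP.eqOn_zero_of_preconnected_of_eventuallyEq_zero
        (isConnected_compl_lattice L).isPreconnected hz h

-- Differentiate the first order equation and divide by `2 ℘'`.
lemma deriv_derivWeierstrassP_of_ne_zero {z : ℂ} (hz : z ∉ L.lattice) (h0 : ℘'[L] z ≠ 0) :
    deriv ℘'[L] z = 6 * ℘[L] z ^ 2 - L.g₂ / 2 := by
  have hP := hasDerivAt_weierstrassP L hz
  have hP' := (L.analyticOnNhd_derivWeierstrassP z hz).differentiableAt.hasDerivAt
  have heq : (fun z ↦ ℘'[L] z ^ 2) =ᶠ[𝓝 z] fun z ↦ 4 * ℘[L] z ^ 3 - L.g₂ * ℘[L] z - L.g₃ :=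
    (L.isClosed_lattice.isOpen_compl.eventually_mem hz).mono L.derivWeierstrassP_sq
  have hlhs := (hP'.fun_pow 2).congr_of_eventuallyEq heq.symm
  have hrhs := (((hP.fun_pow 3).const_mul 4).fun_sub (hP.const_mul L.g₂)).sub_const L.g₃
  have := hlhs.unique hrhs
  apply mul_left_cancel₀ h0
  push_cast at this
  linear_combination this / 2

lemma deriv_derivWeierstrassP {z : ℂ} (hz : z ∉ L.lattice) :
    deriv ℘'[L] z = 6 * ℘[L] z ^ 2 - L.g₂ / 2 := by
  have heq : deriv ℘'[L] =ᶠ[𝓝[≠] z] fun z ↦ 6 * ℘[L] z ^ 2 - L.g₂ / 2 := by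
    filter_upwards [eventually_derivWeierstrassP_ne_zero L hz,
      nhdsWithin_le_nhds (L.isClosed_lattice.isOpen_compl.mem_nhds hz)] with w h0 hw
    exact deriv_derivWeierstrassP_of_ne_zero L hw h0
  have hleft := (L.analyticOnNhd_derivWeierstrassP z hz).deriv.continuousAt
  have hright : ContinuousAt (fun z ↦ 6 * ℘[L] z ^ 2 - L.g₂ / 2) z := by
    have := (L.analyticOnNhd_weierstrassP z hz).continuousAt
    fun_prop
  exact ((hleft.eventuallyEq_nhds_iff_eventuallyEq_nhdsNE hright).1 heq).self_of_nhds

variable {L}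

lemma derivWeierstrassP_eq_zero_of_two_mul_mem {z : ℂ} (hz : 2 * z ∈ L.lattice) :
    ℘'[L] z = 0 := by
  have h := L.derivWeierstrassP_add_coe (-z) ⟨2 * z, hz⟩
  rw [L.derivWeierstrassP_neg, show -z + 2 * z = z by ring] at h
  linear_combination h / 2

/-- Complex conjugation as a permutation of a lattice that it preserves; it reindexes the series
for `℘` and `℘'`. -/
def conjLattice (hL : ∀ l ∈ L.lattice, conj l ∈ L.lattice) : L.lattice ≃ L.lattice where
  toFun l := ⟨conj (l : ℂ), hL l l.2⟩
  invFun l := ⟨conj (l : ℂ), hL l l.2⟩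
  left_inv l := by simp
  right_inv l := by simp

lemma weierstrassP_conj (hL : ∀ l ∈ L.lattice, conj l ∈ L.lattice) (z : ℂ) :
    ℘[L] (conj z) = conj (℘[L] z) := by
  rw [PeriodPair.weierstrassP, PeriodPair.weierstrassP, Complex.conj_tsum,
    ← (conjLattice hL).tsum_eq]
  simp [conjLattice]

lemma derivWeierstrassP_conj (hL : ∀ l ∈ L.lattice, conj l ∈ L.lattice) (z : ℂ) :
    ℘'[L] (conj z) = conj (℘'[L] z) := by
  rw [PeriodPair.derivWeierstrassP, PeriodPair.derivWeierstrassP, map_neg, Complex.conj_tsum,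
    ← (conjLattice hL).tsum_eq]
  simp [conjLattice, map_ofNat]

end Weierstrass

section RealLattice

variable {L : PeriodPair} {z : ℂ}

lemma conj_weierstrassP_of_conj_sub_mem (hL : ∀ l ∈ L.lattice, conj l ∈ L.lattice)
    (hz : conj z - z ∈ L.lattice) : conj (℘[L] z) = ℘[L] z := by
  simpa [weierstrassP_conj hL] using L.weierstrassP_add_coe z ⟨_, hz⟩

lemma conj_weierstrassP_of_conj_add_mem (hL : ∀ l ∈ L.lattice, conj l ∈ L.lattice)
    (hz : conj z + z ∈ L.lattice) : conj (℘[L] z) = ℘[L] z := by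
  simpa [weierstrassP_conj hL, ← sub_eq_add_neg, add_comm] using
    L.weierstrassP_add_coe (-z) ⟨_, hz⟩

lemma conj_derivWeierstrassP_of_conj_sub_mem (hL : ∀ l ∈ L.lattice, conj l ∈ L.lattice)
    (hz : conj z - z ∈ L.lattice) : conj (℘'[L] z) = ℘'[L] z := by
  simpa [derivWeierstrassP_conj hL] using L.derivWeierstrassP_add_coe z ⟨_, hz⟩

lemma conj_derivWeierstrassP_of_conj_add_mem (hL : ∀ l ∈ L.lattice, conj l ∈ L.lattice)
    (hz : conj z + z ∈ L.lattice) : conj (℘'[L] z) = -℘'[L] z := by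
  simpa [derivWeierstrassP_conj hL, add_comm] using L.derivWeierstrassP_add_coe (-z) ⟨_, hz⟩

/-- The cubic `4 x³ - g₂ x - g₃` attached to the lattice has the real roots `e₁ > e₂ > e₃`. -/
structure HasRealRoots (L : PeriodPair) (e₁ e₂ e₃ : ℝ) : Prop where
  cubic_eq : ∀ x : ℂ, 4 * x ^ 3 - L.g₂ * x - L.g₃ = 4 * (x - e₁) * (x - e₂) * (x - e₃)
  lt_fst : e₂ < e₁
  lt_snd : e₃ < e₂

namespace HasRealRoots

variable {e₁ e₂ e₃ : ℝ}

lemma weierstrassP_eq_of_two_mul_mem (he : HasRealRoots L e₁ e₂ e₃) (hz : z ∉ L.lattice)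
    (hz2 : 2 * z ∈ L.lattice) : ℘[L] z = e₁ ∨ ℘[L] z = e₂ ∨ ℘[L] z = e₃ := by
  have hsq := L.derivWeierstrassP_sq z hz
  rw [he.cubic_eq, derivWeierstrassP_eq_zero_of_two_mul_mem hz2, eq_comm] at hsq
  simpa [sub_eq_zero, or_assoc] using hsq

lemma derivWeierstrassP_sq_eq_ofReal (he : HasRealRoots L e₁ e₂ e₃) (hz : z ∉ L.lattice)
    (hreal : conj (℘[L] z) = ℘[L] z) : ℘'[L] z ^ 2 =
      (4 * ((℘[L] z).re - e₁) * ((℘[L] z).re - e₂) * ((℘[L] z).re - e₃) : ℝ) := by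
  rw [L.derivWeierstrassP_sq z hz, he.cubic_eq]
  push_cast
  rw [Complex.conj_eq_iff_re.1 hreal]

lemma cubic_nonneg_of_conj_sub_mem (he : HasRealRoots L e₁ e₂ e₃)
    (hL : ∀ l ∈ L.lattice, conj l ∈ L.lattice) (hz : z ∉ L.lattice)
    (hconj : conj z - z ∈ L.lattice) :
    0 ≤ ((℘[L] z).re - e₁) * ((℘[L] z).re - e₂) * ((℘[L] z).re - e₃) := by
  have hsq := he.derivWeierstrassP_sq_eq_ofReal hz (conj_weierstrassP_of_conj_sub_mem hL hconj)
  rw [← Complex.conj_eq_iff_re.1 (conj_derivWeierstrassP_of_conj_sub_mem hL hconj)] at hsq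
  norm_cast at hsq
  linarith [sq_nonneg (℘'[L] z).re]

lemma cubic_nonpos_of_conj_add_mem (he : HasRealRoots L e₁ e₂ e₃)
    (hL : ∀ l ∈ L.lattice, conj l ∈ L.lattice) (hz : z ∉ L.lattice)
    (hconj : conj z + z ∈ L.lattice) :
    ((℘[L] z).re - e₁) * ((℘[L] z).re - e₂) * ((℘[L] z).re - e₃) ≤ 0 := by
  have hsq := he.derivWeierstrassP_sq_eq_ofReal hz (conj_weierstrassP_of_conj_add_mem hL hconj)
  have hre : (℘'[L] z).re = 0 := by
    have := congrArg Complex.re (conj_derivWeierstrassP_of_conj_add_mem hL hconj)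
    simp only [Complex.conj_re, Complex.neg_re] at this
    linarith
  have hsq_re := congrArg Complex.re hsq
  rw [Complex.ofReal_re, sq, Complex.mul_re, hre] at hsq_re
  linarith [mul_self_nonneg (℘'[L] z).im]

end HasRealRoots

end RealLattice

lemma lt_iff_lt_of_isPreconnected_of_forall_ne {X α : Type*} [TopologicalSpace X] [LinearOrder α]
    [TopologicalSpace α] [OrderClosedTopology α] {s : Set X} (hs : IsPreconnected s) {p : X → α}
    (hp : ContinuousOn p s) {c : α} (hc : ∀ x ∈ s, p x ≠ c) {a b : X} (ha : a ∈ s) (hb : b ∈ s) :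
    c < p a ↔ c < p b := by
  suffices ∀ a ∈ s, ∀ b ∈ s, c < p a → c < p b from ⟨this a ha b hb, this b hb a ha⟩
  intro a ha b hb hac
  by_contra hbc
  obtain ⟨x, hx, hxc⟩ := hs.intermediate_value hb ha hp ⟨not_lt.1 hbc, hac.le⟩
  exact hc x hx hxc

lemma continuousOn_re_weierstrassP {L : PeriodPair} {s : Set ℂ} (hs : ∀ z ∈ s, z ∉ L.lattice) :
    ContinuousOn (fun z ↦ (℘[L] z).re) s :=
  Complex.continuous_re.comp_continuousOn (L.analyticOnNhd_weierstrassP.continuousOn.mono hs)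

/-! ### Rectangular lattices -/

lemma intCast_mul_notMem_Ioo (n : ℤ) (a : ℝ) : n * a ∉ Set.Ioo 0 a := by
  rintro ⟨hpos, hlt⟩
  have ha : 0 < a := hpos.trans hlt
  have h0 : (0 : ℝ) < n := pos_of_mul_pos_left hpos ha.le
  have h1 : (n : ℝ) < 1 := by rwa [mul_lt_iff_lt_one_left ha] at hlt
  norm_cast at h0 h1
  lia

/-- `L` is the rectangular lattice with half periods `K > 0` and `i K'`, `K' > 0`. -/
structure IsRectangular (L : PeriodPair) (K K' : ℝ) : Prop where
  K_pos : 0 < K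
  K'_pos : 0 < K'
  ω₁_eq : L.ω₁ = 2 * (K : ℂ)
  ω₂_eq : L.ω₂ = 2 * I * (K' : ℂ)

namespace IsRectangular

variable {L : PeriodPair} {K K' : ℝ} {z : ℂ}

lemma mem_lattice_iff (h : IsRectangular L K K') :
    z ∈ L.lattice ↔ ∃ m n : ℤ, z.re = m * (2 * K) ∧ z.im = n * (2 * K') := by
  rw [PeriodPair.mem_lattice]
  refine exists₂_congr fun m n ↦ ?_
  rw [h.ω₁_eq, h.ω₂_eq, Complex.ext_iff, eq_comm, @eq_comm _ z.im]
  simp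

lemma two_mul_K_mem (h : IsRectangular L K K') : 2 * (K : ℂ) ∈ L.lattice :=
  h.ω₁_eq ▸ L.ω₁_mem_lattice

lemma two_mul_I_mul_K'_mem (h : IsRectangular L K K') : 2 * (I * (K' : ℂ)) ∈ L.lattice :=
  mul_assoc 2 I (K' : ℂ) ▸ h.ω₂_eq ▸ L.ω₂_mem_lattice

lemma conj_mem (h : IsRectangular L K K') (l : ℂ) (hl : l ∈ L.lattice) : conj l ∈ L.lattice := by
  rw [h.mem_lattice_iff] at hl ⊢
  obtain ⟨m, n, hre, him⟩ := hl
  exact ⟨m, -n, by simpa using hre, by simp [him]⟩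

lemma conj_sub_mem (h : IsRectangular L K K') (n : ℤ) (hz : z.im = n * K') :
    conj z - z ∈ L.lattice :=
  h.mem_lattice_iff.2 ⟨0, -n, by simp, by simp [hz]; ring⟩

lemma conj_add_mem (h : IsRectangular L K K') (n : ℤ) (hz : z.re = n * K) :
    conj z + z ∈ L.lattice :=
  h.mem_lattice_iff.2 ⟨n, 0, by simp [hz]; ring, by simp⟩

lemma notMem_of_re (h : IsRectangular L K K') (hz : z.re ∈ Set.Ioo 0 (2 * K)) :
    z ∉ L.lattice := by
  rw [h.mem_lattice_iff]
  rintro ⟨m, n, hm, -⟩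
  exact intCast_mul_notMem_Ioo m (2 * K) (hm ▸ hz)

lemma notMem_of_im (h : IsRectangular L K K') (hz : z.im ∈ Set.Ioo 0 (2 * K')) :
    z ∉ L.lattice := by
  rw [h.mem_lattice_iff]
  rintro ⟨m, n, -, hn⟩
  exact intCast_mul_notMem_Ioo n (2 * K') (hn ▸ hz)

lemma le_of_lattice_le {M : PeriodPair} {J J' : ℝ} (h : IsRectangular L K K')
    (hM : IsRectangular M J J') (hLM : L.lattice ≤ M.lattice) : J ≤ K ∧ J' ≤ K' := by
  constructor
  · by_contra! hlt
    exact hM.notMem_of_re ⟨by simpa using h.K_pos, by simpa using hlt⟩ (hLM h.two_mul_K_mem)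
  · by_contra! hlt
    exact hM.notMem_of_im ⟨by simpa using h.K'_pos, by simpa using hlt⟩
      (hLM h.two_mul_I_mul_K'_mem)

lemma eq_of_lattice_eq {M : PeriodPair} {J J' : ℝ} (h : IsRectangular L K K')
    (hM : IsRectangular M J J') (hLM : L.lattice = M.lattice) : K = J ∧ K' = J' :=
  ⟨le_antisymm (hM.le_of_lattice_le h hLM.ge).1 (h.le_of_lattice_le hM hLM.le).1,
    le_antisymm (hM.le_of_lattice_le h hLM.ge).2 (h.le_of_lattice_le hM hLM.le).2⟩

variable {e₁ e₂ e₃ : ℝ} {s : Set ℂ} {a b : ℂ}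

-- On a horizontal side the cubic is nonnegative, so `℘` misses the gap between `e₂` and `e₁`.
lemma midpoint_lt_re_weierstrassP_iff_of_horizontal (h : IsRectangular L K K')
    (he : HasRealRoots L e₁ e₂ e₃) (hs : IsPreconnected s) (hsL : ∀ z ∈ s, z ∉ L.lattice) {n : ℤ}
    (him : ∀ z ∈ s, z.im = n * K') (ha : a ∈ s) (hb : b ∈ s) :
    (e₁ + e₂) / 2 < (℘[L] a).re ↔ (e₁ + e₂) / 2 < (℘[L] b).re := by
  refine lt_iff_lt_of_isPreconnected_of_forall_ne hs (continuousOn_re_weierstrassP hsL) ?_ ha hb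
  intro z hz heq
  have hnonneg := he.cubic_nonneg_of_conj_sub_mem h.conj_mem (hsL z hz)
    (h.conj_sub_mem n (him z hz))
  have := he.lt_fst
  have := he.lt_snd
  have : ((℘[L] z).re - e₁) * ((℘[L] z).re - e₂) * ((℘[L] z).re - e₃) < 0 :=
    mul_neg_of_neg_of_pos (mul_neg_of_neg_of_pos (by linarith) (by linarith)) (by linarith)
  linarith

-- On a vertical side the cubic is nonpositive, so `℘` misses the gap between `e₃` and `e₂`.
lemma midpoint_lt_re_weierstrassP_iff_of_vertical (h : IsRectangular L K K')
    (he : HasRealRoots L e₁ e₂ e₃) (hs : IsPreconnected s) (hsL : ∀ z ∈ s, z ∉ L.lattice) {n : ℤ}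
    (hre : ∀ z ∈ s, z.re = n * K) (ha : a ∈ s) (hb : b ∈ s) :
    (e₂ + e₃) / 2 < (℘[L] a).re ↔ (e₂ + e₃) / 2 < (℘[L] b).re := by
  refine lt_iff_lt_of_isPreconnected_of_forall_ne hs (continuousOn_re_weierstrassP hsL) ?_ ha hb
  intro z hz heq
  have hnonpos := he.cubic_nonpos_of_conj_add_mem h.conj_mem (hsL z hz)
    (h.conj_add_mem n (hre z hz))
  have := he.lt_fst
  have := he.lt_snd
  have : 0 < ((℘[L] z).re - e₁) * ((℘[L] z).re - e₂) * ((℘[L] z).re - e₃) :=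
    mul_pos (mul_pos_of_neg_of_neg (by linarith) (by linarith)) (by linarith)
  linarith

end IsRectangular

lemma isPreconnected_reProdIm {s t : Set ℝ} (hs : Convex ℝ s) (ht : Convex ℝ t) :
    IsPreconnected (s ×ℂ t) :=
  ((hs.linear_preimage Complex.reLm).inter (ht.linear_preimage Complex.imLm)).isPreconnected

namespace IsRectangular

variable {L : PeriodPair} {K K' e₁ e₂ e₃ : ℝ}

lemma exists_lt_re_weierstrassP (h : IsRectangular L K K') (c : ℝ) :
    ∃ x ∈ Set.Ioc 0 K, c < (℘[L] (x : ℂ)).re := by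
  obtain ⟨x, hc, hx⟩ := (((tendsto_re_sq_mul_weierstrassP_ray L one_ne_zero).eventually_gt_atTop
    c).and (Ioc_mem_nhdsGT h.K_pos)).exists
  exact ⟨x, hx, by simpa using hc⟩

lemma exists_re_weierstrassP_lt (h : IsRectangular L K K') (c : ℝ) :
    ∃ y ∈ Set.Ioc 0 K', (℘[L] (I * (y : ℂ))).re < c := by
  obtain ⟨y, hc, hy⟩ := (((tendsto_re_sq_mul_weierstrassP_ray L
    Complex.I_ne_zero).eventually_gt_atTop (-c)).and (Ioc_mem_nhdsGT h.K'_pos)).exists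
  exact ⟨y, hy, by simpa using hc⟩

lemma notMem_of_re_eq (h : IsRectangular L K K') {z : ℂ} (hz : z.re = K) : z ∉ L.lattice :=
  h.notMem_of_re ⟨hz ▸ h.K_pos, by linarith [h.K_pos]⟩

lemma notMem_of_im_eq (h : IsRectangular L K K') {z : ℂ} (hz : z.im = K') : z ∉ L.lattice :=
  h.notMem_of_im ⟨hz ▸ h.K'_pos, by linarith [h.K'_pos]⟩

lemma K_notMem (h : IsRectangular L K K') : (K : ℂ) ∉ L.lattice :=
  h.notMem_of_re_eq (by simp)

lemma I_mul_K'_notMem (h : IsRectangular L K K') : I * (K' : ℂ) ∉ L.lattice :=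
  h.notMem_of_im_eq (by simp)

lemma K_add_I_mul_K'_notMem (h : IsRectangular L K K') : (K : ℂ) + I * K' ∉ L.lattice :=
  h.notMem_of_re_eq (by simp)

lemma weierstrassP_K (h : IsRectangular L K K') (he : HasRealRoots L e₁ e₂ e₃) :
    ℘[L] K = e₁ := by
  have hK := h.K_pos
  have hside : ∀ z ∈ Set.Ioc 0 K ×ℂ {0}, z ∉ L.lattice := fun z hz ↦
    h.notMem_of_re ⟨hz.1.1, by linarith [hz.1.2]⟩
  obtain ⟨x, hx, hlt⟩ := h.exists_lt_re_weierstrassP ((e₁ + e₂) / 2)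
  rw [h.midpoint_lt_re_weierstrassP_iff_of_horizontal (b := K) (n := 0) he
    (isPreconnected_reProdIm (convex_Ioc 0 K) (convex_singleton 0)) hside
    (fun z hz ↦ by simpa using hz.2) ⟨by simpa using hx, by simp⟩ ⟨by simpa, by simp⟩] at hlt
  have := he.lt_fst
  have := he.lt_snd
  rcases he.weierstrassP_eq_of_two_mul_mem h.K_notMem h.two_mul_K_mem with hP | hP | hP
  · exact hP
  all_goals
    rw [hP, Complex.ofReal_re] at hlt
    linarith

lemma weierstrassP_I_mul_K' (h : IsRectangular L K K') (he : HasRealRoots L e₁ e₂ e₃) :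
    ℘[L] (I * K') = e₃ := by
  have hK' := h.K'_pos
  have hside : ∀ z ∈ {0} ×ℂ Set.Ioc 0 K', z ∉ L.lattice := fun z hz ↦
    h.notMem_of_im ⟨hz.2.1, by linarith [hz.2.2]⟩
  obtain ⟨y, hy, hlt⟩ := h.exists_re_weierstrassP_lt ((e₂ + e₃) / 2)
  have hnot := hlt.not_gt
  rw [h.midpoint_lt_re_weierstrassP_iff_of_vertical (b := I * K') (n := 0) he
    (isPreconnected_reProdIm (convex_singleton 0) (convex_Ioc 0 K')) hside
    (fun z hz ↦ by simpa using hz.1) ⟨by simp, by simpa using hy⟩ ⟨by simp, by simpa⟩] at hnot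
  have := he.lt_fst
  have := he.lt_snd
  rcases he.weierstrassP_eq_of_two_mul_mem h.I_mul_K'_notMem h.two_mul_I_mul_K'_mem
    with hP | hP | hP
  on_goal 3 => exact hP
  all_goals
    rw [hP, Complex.ofReal_re] at hnot
    linarith

lemma weierstrassP_K_add_I_mul_K' (h : IsRectangular L K K') (he : HasRealRoots L e₁ e₂ e₃) :
    ℘[L] (K + I * K') = e₂ := by
  have hK := h.K_pos
  have hK' := h.K'_pos
  have := he.lt_fst
  have := he.lt_snd
  have hlow : (e₂ + e₃) / 2 < (℘[L] (K + I * K')).re := by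
    rw [h.midpoint_lt_re_weierstrassP_iff_of_vertical (b := K) (n := 1) he
      (isPreconnected_reProdIm (convex_singleton K) (convex_Icc 0 K'))
      (fun z hz ↦ h.notMem_of_re_eq hz.1) (fun z hz ↦ by simpa using hz.1)
      ⟨by simp, by simpa using hK'.le⟩ ⟨by simp, by simpa using hK'.le⟩, h.weierstrassP_K he,
      Complex.ofReal_re]
    linarith
  have hupp : ¬ (e₁ + e₂) / 2 < (℘[L] (K + I * K')).re := by
    rw [h.midpoint_lt_re_weierstrassP_iff_of_horizontal (b := I * K') (n := 1) he
      (isPreconnected_reProdIm (convex_Icc 0 K) (convex_singleton K'))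
      (fun z hz ↦ h.notMem_of_im_eq hz.2) (fun z hz ↦ by simpa using hz.2)
      ⟨by simpa using hK.le, by simp⟩ ⟨by simpa using hK.le, by simp⟩, h.weierstrassP_I_mul_K' he,
      Complex.ofReal_re]
    linarith
  rcases he.weierstrassP_eq_of_two_mul_mem h.K_add_I_mul_K'_notMem
    (by rw [mul_add]; exact add_mem h.two_mul_K_mem h.two_mul_I_mul_K'_mem) with hP | hP | hP
  on_goal 2 => exact hP
  all_goals
    rw [hP, Complex.ofReal_re] at hlow hupp
    linarith

end IsRectangular

/-! ### The elliptic function `dn₂` -/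

/-- The function `1/3 - 2 ℘(u + c)`, which is `dn₂` when `c` is the half period `i K'`. It is put in
normal form, hence takes the value `0` at its poles. -/
noncomputable def ellipticDn (L : PeriodPair) (c : ℂ) : ℂ → ℂ :=
  toMeromorphicNFOn (fun u ↦ 1 / 3 - 2 * ℘[L] (u + c)) Set.univ

section EllipticDn

variable (L : PeriodPair) (c : ℂ) {u : ℂ}

lemma meromorphicOn_const_sub_weierstrassP :
    MeromorphicOn (fun u ↦ 1 / 3 - 2 * ℘[L] (u + c)) Set.univ := fun u _ ↦ by
  have : MeromorphicAt (℘[L] ∘ (· + c)) u :=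
    meromorphicAt_comp_add_const_iff_meromorphicAt.2 (L.meromorphic_weierstrassP _)
  exact (MeromorphicAt.const _ _).fun_sub ((MeromorphicAt.const _ _).fun_mul this)

lemma meromorphicNFOn_ellipticDn : MeromorphicNFOn (ellipticDn L c) Set.univ :=
  meromorphicNFOn_toMeromorphicNFOn _ _

variable {L c}

lemma analyticAt_const_sub_weierstrassP (hu : u + c ∉ L.lattice) :
    AnalyticAt ℂ (fun u ↦ 1 / 3 - 2 * ℘[L] (u + c)) u := by
  have : AnalyticAt ℂ (fun u ↦ ℘[L] (u + c)) u :=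
    (L.analyticOnNhd_weierstrassP _ hu).fun_comp (f := fun u ↦ u + c) (by fun_prop)
  fun_prop

lemma ellipticDn_of_notMem (hu : u + c ∉ L.lattice) :
    ellipticDn L c u = 1 / 3 - 2 * ℘[L] (u + c) := by
  rw [ellipticDn, toMeromorphicNFOn_eq_toMeromorphicNFAt (meromorphicOn_const_sub_weierstrassP L c)
    (Set.mem_univ u), toMeromorphicNFAt_eq_self.2
      (analyticAt_const_sub_weierstrassP hu).meromorphicNFAt]

lemma ellipticDn_eventuallyEq (hu : u + c ∉ L.lattice) :
    ellipticDn L c =ᶠ[𝓝 u] fun u ↦ 1 / 3 - 2 * ℘[L] (u + c) := by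
  have hcont : ContinuousAt (fun u : ℂ ↦ u + c) u := by fun_prop
  filter_upwards [hcont.preimage_mem_nhds (L.isClosed_lattice.isOpen_compl.mem_nhds hu)] with v hv
  exact ellipticDn_of_notMem hv

lemma analyticAt_ellipticDn (hu : u + c ∉ L.lattice) : AnalyticAt ℂ (ellipticDn L c) u :=
  (analyticAt_const_sub_weierstrassP hu).congr (ellipticDn_eventuallyEq hu).symm

lemma meromorphicOrderAt_ellipticDn (hu : u + c ∈ L.lattice) :
    meromorphicOrderAt (ellipticDn L c) u = (-2 : ℤ) := by
  have hmero : MeromorphicAt (℘[L] ∘ (· + c)) u :=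
    meromorphicAt_comp_add_const_iff_meromorphicAt.2 (L.meromorphic_weierstrassP _)
  have horder : meromorphicOrderAt ((fun _ ↦ (-2 : ℂ)) * (℘[L] ∘ (· + c))) u = (-2 : ℤ) := by
    rw [meromorphicOrderAt_mul (by fun_prop) hmero, meromorphicOrderAt_const, if_neg (by norm_num),
      meromorphicOrderAt_comp_add_const_eq_meromorphicOrderAt, L.order_weierstrassP _ hu, zero_add]
    rfl
  have hsplit : (fun u ↦ 1 / 3 - 2 * ℘[L] (u + c)) =
      (fun _ ↦ (1 / 3 : ℂ)) + (fun _ ↦ (-2 : ℂ)) * (℘[L] ∘ (· + c)) := by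
    ext u
    simp [sub_eq_add_neg]
  rw [ellipticDn, meromorphicOrderAt_toMeromorphicNFOn (meromorphicOn_const_sub_weierstrassP L c)
    (Set.mem_univ u), hsplit, meromorphicOrderAt_add_eq_right_of_lt (by fun_prop), horder]
  rw [horder, meromorphicOrderAt_const, if_neg (by norm_num)]
  decide

lemma analyticAt_ellipticDn_iff : AnalyticAt ℂ (ellipticDn L c) u ↔ u + c ∉ L.lattice := by
  refine ⟨fun h hu ↦ ?_, analyticAt_ellipticDn⟩
  have := h.meromorphicOrderAt_nonneg
  rw [meromorphicOrderAt_ellipticDn hu] at this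
  exact absurd this (by decide)

lemma ellipticDn_of_mem (hu : u + c ∈ L.lattice) : ellipticDn L c u = 0 :=
  ((meromorphicNFAt_iff_analyticAt_or.1
    (meromorphicNFOn_ellipticDn L c (Set.mem_univ u))).resolve_left
      fun h ↦ analyticAt_ellipticDn_iff.1 h hu).2.2

lemma ellipticDn_periodic {ω : ℂ} (hω : ω ∈ L.lattice) : Function.Periodic (ellipticDn L c) ω := by
  intro u
  have hmem : u + ω + c ∈ L.lattice ↔ u + c ∈ L.lattice := by
    rw [add_right_comm]
    exact L.lattice.add_mem_iff_left hω
  by_cases hu : u + c ∈ L.lattice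
  · rw [ellipticDn_of_mem hu, ellipticDn_of_mem (hmem.2 hu)]
  · rw [ellipticDn_of_notMem hu, ellipticDn_of_notMem (hmem.not.2 hu), add_right_comm,
      L.weierstrassP_add_coe (u + c) ⟨ω, hω⟩]

-- A period carries the pole at `-c` to a pole.
lemma ellipticDn_periodic_iff {ω : ℂ} : Function.Periodic (ellipticDn L c) ω ↔ ω ∈ L.lattice := by
  refine ⟨fun hω ↦ ?_, ellipticDn_periodic⟩
  by_contra hn
  have hshift : AnalyticAt ℂ (ellipticDn L c) (-c + ω) := analyticAt_ellipticDn (by simpa)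
  have hpole : AnalyticAt ℂ (fun u ↦ ellipticDn L c (u + ω)) (-c) :=
    hshift.fun_comp (f := fun u ↦ u + ω) (by fun_prop)
  rw [funext hω, analyticAt_ellipticDn_iff, neg_add_cancel] at hpole
  exact hpole L.lattice.zero_mem

lemma deriv_ellipticDn (hu : u + c ∉ L.lattice) :
    deriv (ellipticDn L c) u = -2 * ℘'[L] (u + c) := by
  rw [(ellipticDn_eventuallyEq hu).deriv_eq, ((((hasDerivAt_weierstrassP L hu).comp_add_const u
    c).const_mul 2).const_sub (1 / 3)).deriv]
  ring

lemma deriv_deriv_ellipticDn (hu : u + c ∉ L.lattice) :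
    deriv (deriv (ellipticDn L c)) u = L.g₂ - 12 * ℘[L] (u + c) ^ 2 := by
  have hcont : ContinuousAt (fun u : ℂ ↦ u + c) u := by fun_prop
  have hderiv : deriv (ellipticDn L c) =ᶠ[𝓝 u] fun u ↦ -2 * ℘'[L] (u + c) := by
    filter_upwards [hcont.preimage_mem_nhds (L.isClosed_lattice.isOpen_compl.mem_nhds hu)] with v hv
    exact deriv_ellipticDn hv
  have hP' := (L.analyticOnNhd_derivWeierstrassP _ hu).differentiableAt.hasDerivAt
  rw [hderiv.deriv_eq, ((hP'.comp_add_const u c).const_mul (-2)).deriv,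
    deriv_derivWeierstrassP L hu]
  ring

end EllipticDn

/-- The invariants of the lattice `L` are those of the elliptic function `dn₂` of modulus `κ`. -/
structure HasDn2Invariants (L : PeriodPair) (κ : ℝ) : Prop where
  g₂_eq : L.g₂ = 4 / 3 - (κ : ℂ) ^ 2
  g₃_eq : L.g₃ = 8 / 27 - (κ : ℂ) ^ 2 / 3

lemma isHalfPeriods_iff {κ K K' : ℝ} :
    IsHalfPeriods κ K K' ↔ ∃ L, IsRectangular L K K' ∧ HasDn2Invariants L κ :=
  ⟨fun ⟨hK, hK', L, h₁, h₂, hg₂, hg₃⟩ ↦ ⟨L, ⟨hK, hK', h₁, h₂⟩, ⟨hg₂, hg₃⟩⟩,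
    fun ⟨L, hL, hg⟩ ↦ ⟨hL.K_pos, hL.K'_pos, L, hL.ω₁_eq, hL.ω₂_eq, hg.g₂_eq, hg.g₃_eq⟩⟩

lemma HasDn2Invariants.hasRealRoots {L : PeriodPair} {κ : ℝ} (hg : HasDn2Invariants L κ)
    (hκ₀ : κ ≠ 0) (hκ₁ : |κ| < 1) :
    HasRealRoots L (1 / 6 + √(1 - κ ^ 2) / 2) (1 / 6 - √(1 - κ ^ 2) / 2) (-(1 / 3)) := by
  have hκ : κ ^ 2 < 1 := (sq_lt_one_iff_abs_lt_one κ).2 hκ₁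
  have hpos : 0 < √(1 - κ ^ 2) := Real.sqrt_pos.2 (by linarith)
  have hlt : √(1 - κ ^ 2) < 1 := by
    rw [Real.sqrt_lt' one_pos]
    linarith [sq_pos_of_ne_zero hκ₀]
  have hsq : (√(1 - κ ^ 2) : ℂ) ^ 2 = 1 - κ ^ 2 := by
    exact_mod_cast Real.sq_sqrt (by linarith : 0 ≤ 1 - κ ^ 2)
  refine ⟨fun x ↦ ?_, by linarith, by linarith⟩
  rw [hg.g₂_eq, hg.g₃_eq]
  push_cast
  linear_combination (x + 1 / 3) * hsq

namespace IsRectangular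

variable {L : PeriodPair} {κ K K' : ℝ}

lemma isFundamentalPeriods_ellipticDn (h : IsRectangular L K K') (c : ℂ) :
    IsFundamentalPeriods (ellipticDn L c) (2 * (K : ℂ)) (2 * I * (K' : ℂ)) := by
  rw [← h.ω₁_eq, ← h.ω₂_eq]
  refine ⟨L.indep, fun ω ↦ ?_⟩
  simp only [ellipticDn_periodic_iff, PeriodPair.mem_lattice, eq_comm]

lemma meromorphicOrderAt_ellipticDn_I_mul_K' (h : IsRectangular L K K') :
    meromorphicOrderAt (ellipticDn L (I * K')) (I * K') = (-2 : ℤ) :=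
  meromorphicOrderAt_ellipticDn (two_mul (I * (K' : ℂ)) ▸ h.two_mul_I_mul_K'_mem)

lemma isDn2_ellipticDn (h : IsRectangular L K K') (hg : HasDn2Invariants L κ) (hκ₀ : κ ≠ 0)
    (hκ₁ : |κ| < 1) : IsDn2 κ (ellipticDn L (I * K')) := by
  have h0 : (0 : ℂ) + I * K' ∉ L.lattice := by simpa using h.I_mul_K'_notMem
  refine isDn2_iff.2 ⟨meromorphicNFOn_ellipticDn L _, analyticAt_ellipticDn h0, ?_, ?_, ?_⟩
  · rw [ellipticDn_of_notMem h0, zero_add, h.weierstrassP_I_mul_K' (hg.hasRealRoots hκ₀ hκ₁)]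
    norm_num
  · rw [deriv_ellipticDn h0, zero_add,
      derivWeierstrassP_eq_zero_of_two_mul_mem h.two_mul_I_mul_K'_mem, mul_zero]
  · have hcont : ContinuousAt (fun u : ℂ ↦ u + I * K') 0 := by fun_prop
    filter_upwards [hcont.preimage_mem_nhds (L.isClosed_lattice.isOpen_compl.mem_nhds h0)] with u hu
    rw [deriv_deriv_ellipticDn hu, ellipticDn_of_notMem hu, hg.g₂_eq]
    ring

lemma ellipticDn_K (h : IsRectangular L K K') (hg : HasDn2Invariants L κ) (hκ₀ : κ ≠ 0)
    (hκ₁ : |κ| < 1) : ellipticDn L (I * K') K = √(1 - κ ^ 2) := by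
  rw [ellipticDn_of_notMem h.K_add_I_mul_K'_notMem,
    h.weierstrassP_K_add_I_mul_K' (hg.hasRealRoots hκ₀ hκ₁)]
  push_cast
  ring

lemma ellipticDn_K_add_I_mul_K' (h : IsRectangular L K K') (hg : HasDn2Invariants L κ)
    (hκ₀ : κ ≠ 0) (hκ₁ : |κ| < 1) : ellipticDn L (I * K') (K + I * K') = -√(1 - κ ^ 2) := by
  have hshift : (K : ℂ) + I * K' + I * K' = K + 2 * (I * K') := by ring
  have hmem : (K : ℂ) + I * K' + I * K' ∉ L.lattice := h.notMem_of_re_eq (by simp)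
  rw [ellipticDn_of_notMem hmem, hshift, L.weierstrassP_add_coe K ⟨_, h.two_mul_I_mul_K'_mem⟩,
    h.weierstrassP_K (hg.hasRealRoots hκ₀ hκ₁)]
  push_cast
  ring

lemma halfPeriods_unique {M : PeriodPair} {J J' : ℝ} (h : IsRectangular L K K')
    (hg : HasDn2Invariants L κ) (hM : IsRectangular M J J') (hgM : HasDn2Invariants M κ)
    (hκ₀ : κ ≠ 0) (hκ₁ : |κ| < 1) : K = J ∧ K' = J' := by
  have hdn := (h.isDn2_ellipticDn hg hκ₀ hκ₁).unique (hM.isDn2_ellipticDn hgM hκ₀ hκ₁)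
  refine h.eq_of_lattice_eq hM (SetLike.ext fun ω ↦ ?_)
  rw [← ellipticDn_periodic_iff (c := I * K'), hdn, ellipticDn_periodic_iff]

end IsRectangular

/-! ### Eisenstein series on the imaginary axis -/

section EisensteinSeries

open UpperHalfPlane hiding I σ
open ModularForm EisensteinSeries
open scoped ArithmeticFunction.sigma MatrixGroups

variable {k : ℕ} {t : ℝ}

/-- The value `E_k(it)` of the normalised Eisenstein series of weight `k`, given by the
`q`-expansion; this makes it a real number. -/
noncomputable def eisensteinAxis (k : ℕ) (t : ℝ) : ℝ :=
  1 - 2 * k / bernoulli k * ∑' n : ℕ+, σ (k - 1) n * Real.exp (-2 * Real.pi * t) ^ (n : ℕ)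

lemma coe_ofComplex_I_mul (ht : 0 < t) : (ofComplex (I * t) : ℂ) = I * t := by
  rw [ofComplex_apply_of_im_pos (by simpa)]

lemma E_ofComplex_I_mul (hk : 3 ≤ k) (hk₂ : Even k) (ht : 0 < t) :
    E hk (ofComplex (I * t)) = eisensteinAxis k t := by
  have hq : 2 * (Real.pi : ℂ) * I * (I * t) = (-2 * Real.pi * t : ℝ) := by
    push_cast
    linear_combination 2 * (Real.pi : ℂ) * t * Complex.I_sq
  rw [q_expansion_bernoulli hk hk₂, coe_ofComplex_I_mul ht, hq, eisensteinAxis]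
  push_cast
  simp only [zpow_natCast]

lemma eisensteinAxis_four_pos (t : ℝ) : 0 < eisensteinAxis 4 t := by
  have hsum : 0 ≤ ∑' n : ℕ+, (σ (4 - 1) n : ℝ) * Real.exp (-2 * Real.pi * t) ^ (n : ℕ) :=
    tsum_nonneg fun n ↦ by positivity
  rw [eisensteinAxis, bernoulli_eq_bernoulli'_of_ne_one (by norm_num), bernoulli'_four]
  norm_num at hsum ⊢
  linarith

lemma continuousOn_eisensteinAxis (hk : 3 ≤ k) (hk₂ : Even k) :
    ContinuousOn (eisensteinAxis k) (Set.Ioi 0) := by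
  have hE : ContinuousOn (fun t : ℝ ↦ E hk (ofComplex (I * t))) (Set.Ioi 0) :=
    (ModularFormClass.holo (E hk)).continuous.comp_continuousOn continuousOn_ofComplex_I_mul
  refine (Complex.continuous_re.comp_continuousOn hE).congr fun t ht ↦ ?_
  rw [Function.comp_apply, E_ofComplex_I_mul hk hk₂ ht, Complex.ofReal_re]

lemma tendsto_ofComplex_I_mul : Tendsto (fun t : ℝ ↦ ofComplex (I * t)) atTop atImInfty :=
  tendsto_comap_im_ofComplex.comp <| tendsto_comap_iff.2 <| by
    simpa [Function.comp_def] using! tendsto_id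

lemma tendsto_valueAtInfty {k : ℤ} (g : ModularForm 𝒮ℒ k) :
    Tendsto g atImInfty (𝓝 (valueAtInfty g)) := by
  obtain ⟨c, hc, hO⟩ := ModularFormClass.exp_decay_sub_atImInfty' g
  have him : Tendsto UpperHalfPlane.im atImInfty atTop := tendsto_comap
  exact tendsto_sub_nhds_zero_iff.1 <| hO.trans_tendsto <|
    Real.tendsto_exp_atBot.comp (him.const_mul_atTop_of_neg (neg_lt_zero.2 hc))

lemma valueAtInfty_E (hk : 3 ≤ k) (hk₂ : Even k) : valueAtInfty (E hk) = 1 := by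
  rw [← E_qExpansion_coeff_zero hk hk₂, UpperHalfPlane.qExpansion_coeff_zero one_pos
    (ModularFormClass.analyticAt_cuspFunction_zero (E hk) one_pos one_mem_strictPeriods_SL)
    (SlashInvariantFormClass.periodic_comp_ofComplex (E hk) one_mem_strictPeriods_SL)]

lemma tendsto_eisensteinAxis (hk : 3 ≤ k) (hk₂ : Even k) :
    Tendsto (eisensteinAxis k) atTop (𝓝 1) := by
  have hE := (tendsto_valueAtInfty (E hk)).comp tendsto_ofComplex_I_mul
  rw [valueAtInfty_E hk hk₂] at hE
  refine ((Complex.continuous_re.tendsto 1).comp hE).congr' ?_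
  filter_upwards [eventually_gt_atTop 0] with t ht
  simp only [Function.comp_apply, E_ofComplex_I_mul hk hk₂ ht, Complex.ofReal_re]

lemma S_smul_ofComplex_I_mul (ht : 0 < t) :
    ModularGroup.S • ofComplex (I * t) = ofComplex (I * (t⁻¹ : ℝ)) := by
  ext
  rw [modular_S_smul, coe_ofComplex_I_mul (inv_pos.2 ht)]
  simp [coe_ofComplex_I_mul ht, mul_comm]

lemma modularForm_S_smul {k : ℤ} (g : ModularForm 𝒮ℒ k) (z : ℍ) :
    g (ModularGroup.S • z) = (z : ℂ) ^ k * g z := by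
  have hmem : ((ModularGroup.S : SL(2, ℤ)) : GL (Fin 2) ℝ) ∈ 𝒮ℒ := ⟨_, rfl⟩
  have hdenom : denom ((ModularGroup.S : SL(2, ℤ)) : GL (Fin 2) ℝ) z = z := ModularGroup.denom_S z
  rw [← hdenom]
  exact SlashInvariantForm.slash_action_eqn'' g hmem z

lemma eisensteinAxis_inv (hk : 3 ≤ k) (hk₂ : Even k) (ht : 0 < t) :
    eisensteinAxis k t⁻¹ = (-1) ^ (k / 2) * t ^ k * eisensteinAxis k t := by
  have hI : I ^ k = (-1) ^ (k / 2) := by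
    rw [← Complex.I_sq, ← pow_mul, Nat.mul_div_cancel' hk₂.two_dvd]
  have hS := modularForm_S_smul (E hk) (ofComplex (I * t))
  rw [S_smul_ofComplex_I_mul ht, E_ofComplex_I_mul hk hk₂ (inv_pos.2 ht),
    E_ofComplex_I_mul hk hk₂ ht, coe_ofComplex_I_mul ht, zpow_natCast, mul_pow, hI] at hS
  exact_mod_cast hS

/-- The function `E₆ / E₄ ^ (3 / 2)` on the imaginary axis. It depends only on the shape of the
rectangular lattice with half periods `1` and `it`. -/
noncomputable def eisensteinRatio (t : ℝ) : ℝ := eisensteinAxis 6 t / √(eisensteinAxis 4 t) ^ 3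

lemma continuousOn_eisensteinRatio : ContinuousOn eisensteinRatio (Set.Ioi 0) :=
  (continuousOn_eisensteinAxis (by norm_num) (by decide)).div
    ((continuousOn_eisensteinAxis (by norm_num) (by decide)).sqrt.pow 3)
    fun t _ ↦ (pow_pos (Real.sqrt_pos.2 (eisensteinAxis_four_pos t)) 3).ne'

lemma tendsto_eisensteinRatio : Tendsto eisensteinRatio atTop (𝓝 1) := by
  have hlim := (tendsto_eisensteinAxis (k := 6) (by norm_num) (by decide)).div
    ((tendsto_eisensteinAxis (k := 4) (by norm_num) (by decide)).sqrt.pow 3) (by norm_num)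
  rwa [Real.sqrt_one, one_pow, div_one] at hlim

lemma eisensteinRatio_inv (ht : 0 < t) : eisensteinRatio t⁻¹ = -eisensteinRatio t := by
  have hsqrt : √(eisensteinAxis 4 t⁻¹) = t ^ 2 * √(eisensteinAxis 4 t) := by
    rw [eisensteinAxis_inv (by norm_num) (by decide) ht, Real.sqrt_mul (by positivity),
      show (-1) ^ (4 / 2) * t ^ 4 = (t ^ 2) ^ 2 by ring, Real.sqrt_sq (by positivity)]
  have hpos := Real.sqrt_pos.2 (eisensteinAxis_four_pos t)
  rw [eisensteinRatio, eisensteinRatio, hsqrt, eisensteinAxis_inv (by norm_num) (by decide) ht]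
  field_simp
  ring

lemma exists_eisensteinRatio_eq {c : ℝ} (hc : |c| < 1) : ∃ t > 0, eisensteinRatio t = c := by
  obtain ⟨hc₁, hc₂⟩ := abs_lt.1 hc
  have hexists {b : ℝ} (hb : b < 1) : ∃ t > 0, b < eisensteinRatio t :=
    ((eventually_gt_atTop 0).and (tendsto_eisensteinRatio.eventually_const_lt hb)).exists
  obtain ⟨s, hs, hcs⟩ := hexists hc₂
  obtain ⟨r, hr, hcr⟩ := hexists (neg_lt.1 hc₁)
  rw [← neg_lt, ← eisensteinRatio_inv hr] at hcr
  exact isPreconnected_Ioi.intermediate_value (Set.mem_Ioi.2 (inv_pos.2 hr)) (Set.mem_Ioi.2 hs)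
    continuousOn_eisensteinRatio ⟨hcr.le, hcs.le⟩

lemma exists_scaled_eisensteinAxis_eq {a b : ℝ} (ha : 0 < a) (hab : b ^ 2 < a ^ 3) :
    ∃ t > 0, ∃ s > 0, s ^ 4 * eisensteinAxis 4 t = a ∧ s ^ 6 * eisensteinAxis 6 t = b := by
  have hc : |b / √a ^ 3| < 1 := by
    rwa [← sq_lt_one_iff_abs_lt_one, div_pow, div_lt_one (by positivity), pow_right_comm,
      Real.sq_sqrt ha.le]
  obtain ⟨t, ht, hratio⟩ := exists_eisensteinRatio_eq hc
  have hpos : 0 < eisensteinAxis 4 t := eisensteinAxis_four_pos t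
  have hs : √(√a / √(eisensteinAxis 4 t)) ^ 2 = √a / √(eisensteinAxis 4 t) :=
    Real.sq_sqrt (by positivity)
  refine ⟨t, ht, √(√a / √(eisensteinAxis 4 t)), by positivity, ?_, ?_⟩
  · rw [pow_mul _ 2 2, hs, div_pow, Real.sq_sqrt ha.le, Real.sq_sqrt hpos.le,
      div_mul_cancel₀ _ hpos.ne']
  · rw [eisensteinRatio, div_eq_div_iff (by positivity) (by positivity)] at hratio
    rw [pow_mul _ 2 3, hs, div_pow, div_mul_eq_mul_div, div_eq_iff (by positivity), ← hratio]
    ring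

lemma tsum_eisSummand_eq (hk : 3 ≤ k) (z : ℍ) :
    ∑' v, eisSummand k v z = 2 * riemannZeta k * E hk z := by
  rw [tsum_eisSummand_eq_riemannZeta_mul_eisensteinSeries hk,
    show E hk z = (1 / 2 : ℂ) • eisensteinSeriesSIF (N := 1) 0 k z from rfl,
    eisensteinSeriesSIF_apply 0 k z, smul_eq_mul]
  ring

lemma riemannZeta_six : riemannZeta 6 = Real.pi ^ 6 / 945 := by
  have hbernoulli : bernoulli 6 = 1 / 42 := by
    rw [bernoulli_eq_bernoulli'_of_ne_one (by norm_num), bernoulli'_def]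
    have hfive : bernoulli' 5 = 0 := bernoulli'_eq_zero_of_odd (by decide) (by norm_num)
    norm_num [Finset.sum_range_succ, hfive, Nat.choose]
  have hzeta := riemannZeta_two_mul_nat (k := 3) (by norm_num)
  norm_num [hbernoulli, Nat.factorial] at hzeta
  rw [hzeta]
  ring

namespace IsRectangular

variable {L : PeriodPair} {K K' : ℝ}

lemma G_eq (h : IsRectangular L K K') (hk : 3 ≤ k) (hk₂ : Even k) :
    L.G k = ((2 * (K : ℂ)) ^ k)⁻¹ * (2 * riemannZeta k * eisensteinAxis k (K' / K)) := by
  have ht : 0 < K' / K := div_pos h.K'_pos h.K_pos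
  rw [← E_ofComplex_I_mul hk hk₂ ht, ← tsum_eisSummand_eq, ← tsum_mul_left, PeriodPair.G,
    ← L.latticeEquivProd.symm.toEquiv.tsum_eq,
    ← ((finTwoArrowEquiv ℤ).trans (Equiv.prodComm ℤ ℤ)).tsum_eq]
  refine tsum_congr fun v ↦ ?_
  have hv : ((L.latticeEquivProd.symm (v 1, v 0) : L.lattice) : ℂ) =
      2 * K * (v 0 * (I * (K' / K : ℝ)) + v 1) := by
    have hK : (K : ℂ) ≠ 0 := by exact_mod_cast h.K_pos.ne'
    rw [PeriodPair.latticeEquiv_symm_apply, h.ω₁_eq, h.ω₂_eq]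
    push_cast
    field_simp
    ring
  rw [eisSummand, coe_ofComplex_I_mul ht, zpow_neg, zpow_natCast, ← mul_inv, ← mul_pow, ← hv]
  rfl

lemma g₂_eq (h : IsRectangular L K K') :
    L.g₂ = 4 / 3 * (Real.pi / (2 * K)) ^ 4 * eisensteinAxis 4 (K' / K) := by
  have hK : (K : ℂ) ≠ 0 := by exact_mod_cast h.K_pos.ne'
  rw [PeriodPair.g₂, h.G_eq (by norm_num) (by decide), Nat.cast_ofNat, riemannZeta_four]
  field_simp
  ring

lemma g₃_eq (h : IsRectangular L K K') :
    L.g₃ = 8 / 27 * (Real.pi / (2 * K)) ^ 6 * eisensteinAxis 6 (K' / K) := by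
  have hK : (K : ℂ) ≠ 0 := by exact_mod_cast h.K_pos.ne'
  rw [PeriodPair.g₃, h.G_eq (by norm_num) (by decide), Nat.cast_ofNat, riemannZeta_six]
  field_simp
  ring

end IsRectangular

end EisensteinSeries

lemma exists_isRectangular {K K' : ℝ} (hK : 0 < K) (hK' : 0 < K') :
    ∃ L, IsRectangular L K K' := by
  refine ⟨⟨2 * (K : ℂ), 2 * I * (K' : ℂ), LinearIndependent.pair_iff.2 fun a b hab ↦ ?_⟩,
    hK, hK', rfl, rfl⟩
  simpa [Complex.ext_iff, hK.ne', hK'.ne'] using hab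

lemma exists_isRectangular_of_invariants {g₂ g₃ : ℝ} (hg : 27 * g₃ ^ 2 < g₂ ^ 3) :
    ∃ L K K', IsRectangular L K K' ∧ L.g₂ = g₂ ∧ L.g₃ = g₃ := by
  have hg₂ : 0 < g₂ := (Odd.pow_pos_iff (by decide)).1 (by linarith [sq_nonneg g₃] : 0 < g₂ ^ 3)
  obtain ⟨t, ht, s, hs, h₄, h₆⟩ := exists_scaled_eisensteinAxis_eq
    (a := 3 / 4 * g₂) (b := 27 / 8 * g₃) (by positivity) (by linarith)
  have hK : 0 < Real.pi / (2 * s) := by positivity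
  obtain ⟨L, hL⟩ := exists_isRectangular hK (mul_pos ht hK)
  have hscale : (Real.pi : ℂ) / (2 * (Real.pi / (2 * s) : ℝ)) = s := by
    have hπ := Real.pi_ne_zero
    exact_mod_cast (by field_simp : Real.pi / (2 * (Real.pi / (2 * s))) = s)
  refine ⟨L, _, _, hL, ?_, ?_⟩
  · rw [hL.g₂_eq, hscale, mul_div_cancel_right₀ t hK.ne', mul_assoc, ← Complex.ofReal_pow,
      ← Complex.ofReal_mul, h₄]
    push_cast
    ring
  · rw [hL.g₃_eq, hscale, mul_div_cancel_right₀ t hK.ne', mul_assoc, ← Complex.ofReal_pow,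
      ← Complex.ofReal_mul, h₆]
    push_cast
    ring

lemma exists_isRectangular_hasDn2Invariants {κ : ℝ} (hκ₀ : κ ≠ 0) (hκ₁ : |κ| < 1) :
    ∃ L K K', IsRectangular L K K' ∧ HasDn2Invariants L κ := by
  have hdisc : 0 < κ ^ 4 * (1 - κ ^ 2) :=
    mul_pos (by positivity) (sub_pos.2 ((sq_lt_one_iff_abs_lt_one κ).2 hκ₁))
  obtain ⟨L, K, K', hL, hg₂, hg₃⟩ := exists_isRectangular_of_invariants
    (g₂ := 4 / 3 - κ ^ 2) (g₃ := 8 / 27 - κ ^ 2 / 3) (by linarith)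
  exact ⟨L, K, K', hL, by rw [hg₂]; push_cast; rfl, by rw [hg₃]; push_cast; rfl⟩

end ShenDn

theorem mainTheorem8_general (κ : ℝ) (hκ₀ : κ ≠ 0) (hκ₁ : |κ| < 1) :
    (∃! d : ℂ → ℂ, ShenDn.IsDn2 κ d) ∧
    (∃! P : ℝ × ℝ, ShenDn.IsHalfPeriods κ P.1 P.2) ∧
    ∀ (d : ℂ → ℂ) (K K' : ℝ), ShenDn.IsDn2 κ d → ShenDn.IsHalfPeriods κ K K' →
      ShenDn.IsFundamentalPeriods d (2 * (K : ℂ)) (2 * Complex.I * (K' : ℂ)) ∧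
      meromorphicOrderAt d (Complex.I * (K' : ℂ)) = ((-2 : ℤ) : WithTop ℤ) ∧
      d (K : ℂ) = ((Real.sqrt (1 - κ ^ 2) : ℝ) : ℂ) ∧
      d ((K : ℂ) + Complex.I * (K' : ℂ)) = -((Real.sqrt (1 - κ ^ 2) : ℝ) : ℂ) := by
  obtain ⟨L, K, K', hL, hg⟩ := ShenDn.exists_isRectangular_hasDn2Invariants hκ₀ hκ₁
  have hdn := hL.isDn2_ellipticDn hg hκ₀ hκ₁
  refine ⟨⟨_, hdn, fun e he ↦ he.unique hdn⟩,
    ⟨(K, K'), ShenDn.isHalfPeriods_iff.2 ⟨L, hL, hg⟩, ?_⟩, ?_⟩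
  · rintro ⟨J, J'⟩ hJ
    obtain ⟨M, hM, hgM⟩ := ShenDn.isHalfPeriods_iff.1 hJ
    exact Prod.ext_iff.2 (hM.halfPeriods_unique hgM hL hg hκ₀ hκ₁)
  · intro d J J' hd hJ
    obtain ⟨M, hM, hgM⟩ := ShenDn.isHalfPeriods_iff.1 hJ
    rw [hd.unique (hM.isDn2_ellipticDn hgM hκ₀ hκ₁)]
    exact ⟨hM.isFundamentalPeriods_ellipticDn _, hM.meromorphicOrderAt_ellipticDn_I_mul_K',
      hM.ellipticDn_K hgM hκ₀ hκ₁, hM.ellipticDn_K_add_I_mul_K' hgM hκ₀ hκ₁⟩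

theorem mainTheorem8 (κ : ℝ) (hκ₀ : 0 < κ) (hκ₁ : κ < 1) :
    (∃! d : ℂ → ℂ, ShenDn.IsDn2 κ d) ∧
    (∃! P : ℝ × ℝ, ShenDn.IsHalfPeriods κ P.1 P.2) ∧
    ∀ (d : ℂ → ℂ) (K K' : ℝ), ShenDn.IsDn2 κ d → ShenDn.IsHalfPeriods κ K K' →
      ShenDn.IsFundamentalPeriods d (2 * (K : ℂ)) (2 * Complex.I * (K' : ℂ)) ∧
      meromorphicOrderAt d (Complex.I * (K' : ℂ)) = ((-2 : ℤ) : WithTop ℤ) ∧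
      d (K : ℂ) = ((Real.sqrt (1 - κ ^ 2) : ℝ) : ℂ) ∧
      d ((K : ℂ) + Complex.I * (K' : ℂ)) = -((Real.sqrt (1 - κ ^ 2) : ℝ) : ℂ) :=
  mainTheorem8_general κ hκ₀.ne' (abs_lt.2 ⟨by linarith, hκ₁⟩)
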